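/- For a set $T \subseteq \{\mathsf X,\mathsf F,\mathsf G,\mathsf U\}$ of temporal operators let $\mathrm{LTL\text{-}MC}(T)$ be the following decision problem: given a finite Kripke structure $\mathcal A=(W,R,V)$ with total transition relation $R$, a world $w\in W$, and an LTL formula $\varphi$ (built from propositions, $\neg$, $\wedge$ and temporal operators from $T$), does $(\mathcal A,\pi)\models\varphi$ hold for all infinite paths $\pi$ of $\mathcal A$ that start in $w$? Let $\mathrm{td}$ be the parameter that maps an instance $(\mathcal A,w,\varphi)$ to the temporal depth of $\varphi$, i.e. the maximal nesting depth of temporal operators in $\varphi$. The class $\mathrm{W}[\mathrm P]$ consists of the parameterised problems $(Q,\kappa)$, $\kappa$ computable, for which there are a computable function $f$ and a nondeterministic Turing machine that decides whether $x\in Q$ in time $f(\kappa(x))\cdot|x|^{O(1)}$ with at most $O(\kappa(x)\cdot\log|x|)$ nondeterministic steps; $\mathrm{coW}[\mathrm P]$ consists of the parameterised problems $(Q,\kappa)$ whose complement $(\overline Q,\kappa)$ is in $\mathrm{W}[\mathrm P]$. **Theorem.** Let $T\subseteq\{\mathsf X\}$. Then $(\mathrm{LTL\text{-}MC}(T),\mathrm{td})\in\mathrm{coW}[\mathrm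 P]$. -/

import Mathlib

/-! ### Linear temporal logic -/

/-- The temporal operators. -/
inductive TempOp
  | X | F | G | U

/-- LTL formulas over the set `P` of propositions. -/
inductive LTL (P : Type) : Type
  | var : P → LTL P
  | neg : LTL P → LTL P
  | and : LTL P → LTL P → LTL P
  | next : LTL P → LTL P
  | fin : LTL P → LTL P
  | glob : LTL P → LTL P
  | untl : LTL P → LTL P → LTL P

namespace LTL

variable {P : Type}

/-- The set of temporal operators that occur in a formula. -/
def ops : LTL P → Set TempOp
  | var _ => ∅
  | neg φ => φ.ops
  | and φ ψ => φ.ops ∪ ψ.ops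
  | next φ => {TempOp.X} ∪ φ.ops
  | fin φ => {TempOp.F} ∪ φ.ops
  | glob φ => {TempOp.G} ∪ φ.ops
  | .untl φ ψ => {TempOp.U} ∪ (φ.ops ∪ ψ.ops)

/-- Temporal depth. -/
def td : LTL P → ℕ
  | var _ => 0
  | neg φ => φ.td
  | and φ ψ => max φ.td ψ.td
  | next φ => φ.td + 1
  | fin φ => φ.td + 1
  | glob φ => φ.td + 1
  | .untl φ ψ => max φ.td ψ.td + 1

end LTL

/-- Kripke structures with set of worlds `W` over the propositions `P`;
the transition relation is total. -/
structure Kripke (W P : Type) where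
  R : W → W → Prop
  total : ∀ w, ∃ w', R w w'
  V : W → Set P

namespace Kripke

variable {W P : Type}

/-- `π` is an (infinite) path of `A`. -/
def IsPath (A : Kripke W P) (π : ℕ → W) : Prop :=
  ∀ i, A.R (π i) (π (i + 1))

/-- `A.Sat π φ` is `(A, π) ⊨ φ`; the suffix `π^k` is `fun i => π (i + k)`. -/
def Sat (A : Kripke W P) : (ℕ → W) → LTL P → Prop
  | π, .var p => p ∈ A.V (π 0)
  | π, .neg φ => ¬ A.Sat π φ
  | π, .and φ ψ => A.Sat π φ ∧ A.Sat π ψ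
  | π, .next φ => A.Sat (fun i => π (i + 1)) φ
  | π, .fin φ => ∃ k : ℕ, A.Sat (fun i => π (i + k)) φ
  | π, .glob φ => ∀ k : ℕ, A.Sat (fun i => π (i + k)) φ
  | π, .untl φ ψ => ∃ k : ℕ, (∀ j < k, A.Sat (fun i => π (i + j)) φ) ∧
      A.Sat (fun i => π (i + k)) ψ

end Kripke

/-! ### Parameterised problems, nondeterministic machines, and `W[P]` -/

/-- A decision problem over the alphabet `α` together with a parameter for every word. That the
parameter is computable is demanded in the definition of the complexity classes. -/
structure ParamProblem (α : Type) where
  lang : Set (List α)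
  param : List α → ℕ

/-- The complement of a parameterised problem: the complementary language, the same parameter. -/
def ParamProblem.compl {α : Type} (Q : ParamProblem α) : ParamProblem α where
  lang := Q.langᶜ
  param := Q.param

/-- Nondeterministic Turing machines over the input alphabet `α`, in the model that Mathlib uses for
polynomial time (`Turing.FinTM2`): a finite control with finitely many labels `Λ` and a finite
internal memory `σ`, working on finitely many stacks `K` over finite alphabets (two stacks make up
one tape).  Nondeterminism: a label carries a finite list of statements, any of which may be
executed. A computation that halts is accepting if its final internal memory is in `accept`. -/
structure NTM (α : Type) where
  K : Type
  [decK : DecidableEq K]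
  [finK : Fintype K]
  Γ : K → Type
  [finΓ : ∀ k, Fintype (Γ k)]
  /-- the input stack -/
  k₀ : K
  /-- the input symbols are among the symbols of the input stack -/
  input : α ↪ Γ k₀
  Λ : Type
  [finΛ : Fintype Λ]
  main : Λ
  σ : Type
  [finσ : Fintype σ]
  init : σ
  m : Λ → List (Turing.TM2.Stmt Γ Λ σ)
  accept : Set σ

namespace NTM

variable {α : Type}

attribute [instance] NTM.decK NTM.finK NTM.finΓ NTM.finΛ NTM.finσ

/-- Configurations: the current label (`none` when halted), the memory and the stacks. -/
abbrev Cfg (M : NTM α) : Type := Turing.TM2.Cfg M.Γ M.Λ M.σ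

/-- The initial configuration: the word `x` on the input stack (first letter on top), the other
stacks empty. -/
def initCfg (M : NTM α) (x : List α) : M.Cfg where
  l := some M.main
  var := M.init
  stk := Function.update (fun _ => []) M.k₀ (x.map M.input)

/-- `M.Run c t g c'`: there is a computation from `c` to `c'` of `t` steps, `g` of which are
nondeterministic, that is, are made at a label that offers more than one statement. -/
inductive Run (M : NTM α) : M.Cfg → ℕ → ℕ → M.Cfg → Prop
  | refl (c : M.Cfg) : Run M c 0 0 c
  | step {c c' : M.Cfg} {t g : ℕ} (l : M.Λ) (s : Turing.TM2.Stmt M.Γ M.Λ M.σ)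
      (hl : c.l = some l) (hs : s ∈ M.m l)
      (h : Run M (Turing.TM2.stepAux s c.var c.stk) t g c') :
      Run M c (t + 1) (g + if 1 < (M.m l).length then 1 else 0) c'

/-- Some computation on input `x` halts and accepts. -/
def Accepts (M : NTM α) (x : List α) : Prop :=
  ∃ t g c, M.Run (M.initCfg x) t g c ∧ c.l = none ∧ c.var ∈ M.accept

/-- `M` decides `L`, and every computation of `M` on an input `x` has at most `time x` steps, at
most `guesses x` of which are nondeterministic. -/
def DecidesWithin (M : NTM α) (L : Set (List α)) (time guesses : List α → ℕ) : Prop :=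
  (∀ x t g c, M.Run (M.initCfg x) t g c → t ≤ time x ∧ g ≤ guesses x) ∧
    ∀ x, x ∈ L ↔ M.Accepts x

end NTM

/-- The class `W[P]` (over the alphabet `α`): the problems with a computable parameter `κ` that are
decided by a nondeterministic machine in time `f(κ(x)) · |x|^O(1)`, `f` computable, with
`O(κ(x) · log |x|)` nondeterministic steps. -/
def WP (α : Type) [Finite α] [Primcodable α] : Set (ParamProblem α) :=
  {Q | Computable Q.param ∧
    ∃ (f : ℕ → ℕ) (p : Polynomial ℕ) (C : ℕ) (M : NTM α), Computable f ∧
      M.DecidesWithin Q.lang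
        (fun x => f (Q.param x) * p.eval x.length)
        (fun x => C * (Q.param x * Nat.log 2 x.length))}

/-- The class `coW[P]`. -/
def coWP (α : Type) [Finite α] [Primcodable α] : Set (ParamProblem α) :=
  {Q | Q.compl ∈ WP α}

/-! ### The model checking problem as a problem on words -/

/-- The alphabet in which instances are written. -/
inductive Letter
  | zero | one | sep | var | neg | and | next | fin | glob | untl
  deriving DecidableEq

namespace Letter

/-- The numbering of the letters, used only to make `Letter` a finite and `Primcodable` type. -/
def toFin : Letter → Fin 10
  | zero => 0 | one => 1 | sep => 2 | var => 3 | neg => 4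
  | and => 5 | next => 6 | fin => 7 | glob => 8 | .untl => 9

theorem toFin_bijective : Function.Bijective toFin := by
  constructor
  · intro a b h
    cases a <;> cases b <;> first | rfl | exact absurd h (by decide)
  · intro i
    fin_cases i
    exacts [⟨zero, rfl⟩, ⟨one, rfl⟩, ⟨sep, rfl⟩, ⟨var, rfl⟩, ⟨neg, rfl⟩, ⟨and, rfl⟩, ⟨next, rfl⟩,
      ⟨fin, rfl⟩, ⟨glob, rfl⟩, ⟨untl, rfl⟩]

instance : Finite Letter :=
  Finite.of_injective toFin toFin_bijective.1

noncomputable instance : Primcodable Letter :=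
  Primcodable.ofEquiv (Fin 10) (Equiv.ofBijective toFin toFin_bijective)

end Letter

/-- Prefix notation; the propositions are numbers, written in unary. -/
def LTL.encode {m : ℕ} : LTL (Fin m) → List Letter
  | .var i => Letter.var :: (List.replicate i Letter.one ++ [Letter.sep])
  | .neg φ => Letter.neg :: φ.encode
  | .and φ ψ => Letter.and :: (φ.encode ++ ψ.encode)
  | .next φ => Letter.next :: φ.encode
  | .fin φ => Letter.fin :: φ.encode
  | .glob φ => Letter.glob :: φ.encode
  | .untl φ ψ => Letter.untl :: (φ.encode ++ ψ.encode)

/-- A triple of a finite Kripke structure, a world and a formula; the worlds are `0, …, n - 1` and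
the propositions `0, …, m - 1`. -/
structure MCInstance where
  n : ℕ
  m : ℕ
  A : Kripke (Fin n) (Fin m)
  w : Fin n
  φ : LTL (Fin m)

namespace MCInstance

open Classical in
/-- One letter for a truth value. -/
noncomputable def bit (p : Prop) : Letter := if p then Letter.one else Letter.zero

/-- An instance as a word: `n` and `m` in unary, the rows of the adjacency matrix, the rows of the
valuation matrix, the world in unary, and the formula. -/
noncomputable def encode (I : MCInstance) : List Letter :=
  List.replicate I.n Letter.one ++ Letter.sep ::
  (List.replicate I.m Letter.one ++ Letter.sep ::
  (((List.finRange I.n).flatMap fun i => (List.finRange I.n).map fun j => bit (I.A.R i j)) ++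
  (((List.finRange I.n).flatMap fun i => (List.finRange I.m).map fun p => bit (p ∈ I.A.V i)) ++
  (List.replicate I.w Letter.one ++ Letter.sep ::
  I.φ.encode))))

/-- `φ` holds on all paths of `A` that start in `w`. -/
def Holds (I : MCInstance) : Prop :=
  ∀ π : ℕ → Fin I.n, I.A.IsPath π → π 0 = I.w → I.A.Sat π I.φ

theorem replicate_sep_inj {a b : ℕ} {s t : List Letter}
    (h : List.replicate a Letter.one ++ Letter.sep :: s = List.replicate b Letter.one ++ Letter.sep :: t) :
    a = b ∧ s = t := by
  induction a generalizing b with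
  | zero => cases b <;> simp_all [List.replicate_succ]
  | succ a ih =>
    cases b with
    | zero => simp [List.replicate_succ] at h
    | succ b =>
      simp only [List.replicate_succ, List.cons_append, List.cons.injEq, true_and] at h
      obtain ⟨h1, h2⟩ := ih h
      exact ⟨by rw [h1], h2⟩

/-- Unique readability of formulas. -/
theorem formula_encode_inj {m : ℕ} : ∀ (φ ψ : LTL (Fin m)) (s t : List Letter),
    φ.encode ++ s = ψ.encode ++ t → φ = ψ ∧ s = t := by
  intro φ
  induction φ with
  | var i =>
    intro ψ s t h
    cases ψ <;> simp [LTL.encode] at h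
    obtain ⟨h1, h2⟩ := replicate_sep_inj h
    exact ⟨by rw [Fin.ext h1], h2⟩
  | neg φ ih =>
    intro ψ s t h
    cases ψ <;> simp [LTL.encode] at h
    obtain ⟨h1, h2⟩ := ih _ _ _ h
    exact ⟨by rw [h1], h2⟩
  | and φ₁ φ₂ ih₁ ih₂ =>
    intro ψ s t h
    cases ψ <;> simp [LTL.encode] at h
    obtain ⟨h1, h2⟩ := ih₁ _ _ _ h
    obtain ⟨h3, h4⟩ := ih₂ _ _ _ h2
    exact ⟨by rw [h1, h3], h4⟩
  | next φ ih =>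
    intro ψ s t h
    cases ψ <;> simp [LTL.encode] at h
    obtain ⟨h1, h2⟩ := ih _ _ _ h
    exact ⟨by rw [h1], h2⟩
  | fin φ ih =>
    intro ψ s t h
    cases ψ <;> simp [LTL.encode] at h
    obtain ⟨h1, h2⟩ := ih _ _ _ h
    exact ⟨by rw [h1], h2⟩
  | glob φ ih =>
    intro ψ s t h
    cases ψ <;> simp [LTL.encode] at h
    obtain ⟨h1, h2⟩ := ih _ _ _ h
    exact ⟨by rw [h1], h2⟩
  | untl φ₁ φ₂ ih₁ ih₂ =>
    intro ψ s t h
    cases ψ <;> simp [LTL.encode] at h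
    obtain ⟨h1, h2⟩ := ih₁ _ _ _ h
    obtain ⟨h3, h4⟩ := ih₂ _ _ _ h2
    exact ⟨by rw [h1, h3], h4⟩

theorem bit_inj {p q : Prop} (h : bit p = bit q) : p ↔ q := by
  by_cases hp : p <;> by_cases hq : q <;> simp_all [bit]

theorem flatMap_length {n k : ℕ} (f : Fin n → Fin k → Prop) :
    ((List.finRange n).flatMap fun i => (List.finRange k).map fun j => bit (f i j)).length
      = n * k := by
  simp [List.length_flatMap]

theorem flatMap_inj {n k : ℕ} {f g : Fin n → Fin k → Prop} (l : List (Fin n))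
    (h : (l.flatMap fun i => (List.finRange k).map fun j => bit (f i j))
      = l.flatMap fun i => (List.finRange k).map fun j => bit (g i j)) :
    ∀ i ∈ l, ∀ j, f i j ↔ g i j := by
  induction l with
  | nil => simp
  | cons a l ih =>
    rw [List.flatMap_cons, List.flatMap_cons] at h
    obtain ⟨h1, h2⟩ := List.append_inj h (by simp)
    intro i hi j
    rcases List.mem_cons.1 hi with rfl | hi
    · exact bit_inj (List.map_inj_left.1 h1 j (List.mem_finRange j))
    · exact ih h2 i hi j

/-- Different instances are different words. -/
theorem encode_injective : Function.Injective encode := by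
  rintro ⟨n, m, A, w, φ⟩ ⟨n', m', A', w', φ'⟩ h
  simp only [encode] at h
  obtain ⟨rfl, h⟩ := replicate_sep_inj h
  obtain ⟨rfl, h⟩ := replicate_sep_inj h
  obtain ⟨hR, h⟩ := List.append_inj h (by rw [flatMap_length, flatMap_length])
  obtain ⟨hV, h⟩ := List.append_inj h
    (by rw [flatMap_length fun i p => p ∈ A.V i, flatMap_length fun i p => p ∈ A'.V i])
  obtain ⟨hw, h⟩ := replicate_sep_inj h
  obtain ⟨rfl, -⟩ := formula_encode_inj φ φ' [] [] (by simpa using h)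
  obtain rfl := Fin.ext hw
  have hA : A = A' := by
    obtain ⟨R, hT, V⟩ := A
    obtain ⟨R', hT', V'⟩ := A'
    have h1 : R = R' := by
      funext i j
      exact propext (flatMap_inj _ hR i (List.mem_finRange i) j)
    have h2 : V = V' := by
      funext i
      ext p
      exact flatMap_inj (f := fun i p => p ∈ V i) (g := fun i p => p ∈ V' i) _ hV i
        (List.mem_finRange i) p
    subst h1 h2
    rfl
  rw [hA]

end MCInstance

open Classical in
/-- The temporal depth of the formula of an instance, as a parameter on words (`0` on words that are
no instances). -/
noncomputable def tdParam (x : List Letter) : ℕ :=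
  if h : ∃ I : MCInstance, I.encode = x then h.choose.φ.td else 0

theorem tdParam_encode (I : MCInstance) : tdParam I.encode = I.φ.td := by
  have h : ∃ J : MCInstance, J.encode = I.encode := ⟨I, rfl⟩
  rw [tdParam, dif_pos h, MCInstance.encode_injective h.choose_spec]

/-- Model checking for the formulas with temporal operators from `T`, parameterised by temporal
depth: does `φ` hold on all paths of `A` from `w`? -/
noncomputable def LTLMC (T : Set TempOp) : ParamProblem Letter where
  lang := {x | ∃ I : MCInstance, I.encode = x ∧ I.φ.ops ⊆ T ∧ I.Holds}
  param := tdParam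

/-! A formula of temporal depth d whose only operator is `X` looks at no more than the first d + 1
worlds of a path. By totality every finite walk extends to a path, so a counterexample is a walk of
d steps. Each step is a choice among at most n worlds and costs at most ⌈log₂ n⌉ binary guesses. The
encoding contains an n × n matrix, so ⌈log₂ n⌉ ≤ log₂ |x|, and d · log₂ |x| guesses suffice.

The walk is not stored but consumed by progression: `Fm.fwd` replaces the propositions outside every
`X` by their values in the current world and strips the outermost `X`. The result holds on the
suffix of the path iff the formula holds on the path (`Fm.sat_fwd`), its depth has dropped by one
(`Fm.td_fwd`) and its length has not grown (`Fm.length_toks_fwd`). With `refuted_iff_step` and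
`refuted_iff_val` this is a recursion of d + 1 rounds of polynomial time (`loop_spec`). A successor
is guessed by repeatedly halving the set of candidates (`choose_spec`). Words that are no instances
over `T` are accepted at once. The defect is found in the header or in the first pass over the
formula, so before any guess, and the guess bound holds even if the parameter of such a word is 0.

The machine is verified backwards. `At` bundles a time bound, a guess bound and the acceptance
condition P of a configuration, and the lemma on a loop derives `At` for its entry from `At` for its
exit.

Membership also needs a computable parameter. `tdParam` is defined by choice; `tdParam_eq_wordTd`
identifies it with the result of a primitive recursive parser. -/

/-! ### Bounds and acceptance for nondeterministic machines -/

namespace NTM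

variable {α : Type} {M : NTM α}

/-- Every computation from `c` has at most `T` steps, at most `G` of them nondeterministic, and
there is an accepting computation from `c` iff `P`. -/
def Spec (M : NTM α) (c : M.Cfg) (T G : ℕ) (P : Prop) : Prop :=
  (∀ t g c', M.Run c t g c' → t ≤ T ∧ g ≤ G) ∧
    ((∃ t g c', M.Run c t g c' ∧ c'.l = none ∧ c'.var ∈ M.accept) ↔ P)

theorem Spec.mono {c : M.Cfg} {T T' G G' : ℕ} {P : Prop} (h : M.Spec c T G P) (hT : T ≤ T')
    (hG : G ≤ G') : M.Spec c T' G' P :=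
  ⟨fun t g c' hr => ⟨(h.1 t g c' hr).1.trans hT, (h.1 t g c' hr).2.trans hG⟩, h.2⟩

theorem Spec.halt {c : M.Cfg} (hc : c.l = none) (T G : ℕ) {P : Prop}
    (hP : c.var ∈ M.accept ↔ P) : M.Spec c T G P := by
  have key : ∀ t g c', M.Run c t g c' → t = 0 ∧ g = 0 ∧ c' = c := by
    intro t g c' h
    cases h with
    | refl => exact ⟨rfl, rfl, rfl⟩
    | step l s hl _ _ => rw [hc] at hl; cases hl
  refine ⟨fun t g c' h => ?_, ?_⟩
  · obtain ⟨rfl, rfl, -⟩ := key t g c' h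
    exact ⟨Nat.zero_le _, Nat.zero_le _⟩
  · rw [← hP]
    constructor
    · rintro ⟨t, g, c', h, -, ha⟩
      obtain ⟨-, -, rfl⟩ := key t g c' h
      exact ha
    · exact fun ha => ⟨0, 0, c, .refl c, hc, ha⟩

/-- A label with one statement has one successor configuration, and the step is not counted as
nondeterministic. -/
theorem Spec.step {l : M.Λ} {s : Turing.TM2.Stmt M.Γ M.Λ M.σ} {v : M.σ}
    {S : ∀ k, List (M.Γ k)} {T G : ℕ} {P : Prop} (hm : M.m l = [s])
    (h : M.Spec (Turing.TM2.stepAux s v S) T G P) : M.Spec ⟨some l, v, S⟩ (T + 1) G P := by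
  constructor
  · intro t g c' hr
    cases hr with
    | refl => exact ⟨Nat.zero_le _, Nat.zero_le _⟩
    | step l' s' hl hs hr =>
      cases hl
      rw [hm, List.mem_singleton] at hs
      subst hs
      obtain ⟨h1, h2⟩ := h.1 _ _ _ hr
      simp [hm]
      omega
  · rw [← h.2]
    constructor
    · rintro ⟨t, g, c', hr, hn, ha⟩
      cases hr with
      | refl => cases hn
      | step l' s' hl hs hr =>
        cases hl
        rw [hm, List.mem_singleton] at hs
        subst hs
        exact ⟨_, _, _, hr, hn, ha⟩
    · rintro ⟨t, g, c', hr, hn, ha⟩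
      exact ⟨_, _, _, .step l s rfl (by simp [hm]) hr, hn, ha⟩

/-- Acceptance is existential, so two branches give a disjunction, while the bounds must hold for
both. -/
theorem Spec.choice {l : M.Λ} {s₁ s₂ : Turing.TM2.Stmt M.Γ M.Λ M.σ} {v : M.σ}
    {S : ∀ k, List (M.Γ k)} {T G : ℕ} {P₁ P₂ : Prop} (hm : M.m l = [s₁, s₂])
    (h₁ : M.Spec (Turing.TM2.stepAux s₁ v S) T G P₁)
    (h₂ : M.Spec (Turing.TM2.stepAux s₂ v S) T G P₂) :
    M.Spec ⟨some l, v, S⟩ (T + 1) (G + 1) (P₁ ∨ P₂) := by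
  constructor
  · intro t g c' hr
    cases hr with
    | refl => exact ⟨Nat.zero_le _, Nat.zero_le _⟩
    | step l' s' hl hs hr =>
      cases hl
      rw [hm] at hs
      simp only [hm, List.length_cons, List.length_nil]
      rcases List.mem_pair.1 hs with rfl | rfl
      · obtain ⟨h3, h4⟩ := h₁.1 _ _ _ hr
        simp; omega
      · obtain ⟨h3, h4⟩ := h₂.1 _ _ _ hr
        simp; omega
  · rw [← h₁.2, ← h₂.2]
    constructor
    · rintro ⟨t, g, c', hr, hn, ha⟩
      cases hr with
      | refl => cases hn
      | step l' s' hl hs hr =>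
        cases hl
        rw [hm] at hs
        rcases List.mem_pair.1 hs with rfl | rfl
        · exact .inl ⟨_, _, _, hr, hn, ha⟩
        · exact .inr ⟨_, _, _, hr, hn, ha⟩
    · rintro (⟨t, g, c', hr, hn, ha⟩ | ⟨t, g, c', hr, hn, ha⟩)
      · exact ⟨_, _, _, .step l s₁ rfl (by simp [hm]) hr, hn, ha⟩
      · exact ⟨_, _, _, .step l s₂ rfl (by simp [hm]) hr, hn, ha⟩

end NTM

/-! ### The machine -/

namespace NextMC

/-- The stack symbols: the letters and the truth values. -/
abbrev Sym : Type := Letter ⊕ Bool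

/-- The stacks of the machine. -/
inductive Stack
  | F | NA | NB | NC | ND | M | MD | R | R2 | V | V2 | RR | VR | VT | H | P | B | E
  deriving DecidableEq

instance : Fintype Stack :=
  ⟨{.F, .NA, .NB, .NC, .ND, .M, .MD, .R, .R2, .V, .V2, .RR, .VR, .VT, .H, .P, .B, .E},
    by intro k; cases k <;> decide⟩

/-- The contents of all stacks. -/
structure Store where
  F : List Sym := []
  NA : List Sym := []
  NB : List Sym := []
  NC : List Sym := []
  ND : List Sym := []
  M : List Sym := []
  MD : List Sym := []
  R : List Sym := []
  R2 : List Sym := []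
  V : List Sym := []
  V2 : List Sym := []
  RR : List Sym := []
  VR : List Sym := []
  VT : List Sym := []
  H : List Sym := []
  P : List Sym := []
  B : List Sym := []
  E : List Sym := []

/-- The content of a given stack. -/
@[simp] def Store.get (S : Store) : Stack → List Sym
  | .F => S.F | .NA => S.NA | .NB => S.NB | .NC => S.NC | .ND => S.ND | .M => S.M | .MD => S.MD
  | .R => S.R | .R2 => S.R2 | .V => S.V | .V2 => S.V2 | .RR => S.RR | .VR => S.VR | .VT => S.VT
  | .H => S.H | .P => S.P | .B => S.B | .E => S.E

/-- Replace the content of a given stack. -/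
@[simp] def Store.set (S : Store) (l : List Sym) : Stack → Store
  | .F => { S with F := l } | .NA => { S with NA := l } | .NB => { S with NB := l }
  | .NC => { S with NC := l } | .ND => { S with ND := l } | .M => { S with M := l }
  | .MD => { S with MD := l }
  | .R => { S with R := l } | .R2 => { S with R2 := l } | .V => { S with V := l }
  | .V2 => { S with V2 := l } | .RR => { S with RR := l } | .VR => { S with VR := l }
  | .VT => { S with VT := l } | .H => { S with H := l } | .P => { S with P := l }
  | .B => { S with B := l } | .E => { S with E := l }

/-- Configurations hold a function on `Stack`. The record form is preferred for reasoning because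
updates of different fields commute by computation. -/
theorem Store.update_get (S : Store) (k : Stack) (l : List Sym) :
    Function.update S.get k l = (S.set l k).get := by
  funext k'
  by_cases h : k' = k
  · subst h
    cases k' <;> simp
  · rw [Function.update_of_ne h]
    cases k <;> cases k' <;> first | rfl | exact absurd rfl h

/-- The labels. -/
inductive Lab
  | readN | readM
  | rowR | bitR (nz : Bool) | backR
  | rowV | bitV | backV
  | readW | padW
  | clear | pick | pickR (b : Bool) | pickV (b : Bool) | restR | restV
  | pass (seen : Bool) | var (b seen : Bool) | back (seen : Bool)
  | eval
  | copy | scan (a b : Bool) | guess | thin (g : Bool)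
  deriving Fintype

open Turing.TM2 (Stmt)

/-- Statements of the machine; the memory holds the symbol that was popped last. -/
abbrev Prg : Type := Stmt (fun _ : Stack => Sym) Lab (Option Sym)

namespace Prg

def rd (k : Stack) (q : Prg) : Prg := .pop k (fun _ t => t) q
def ifs (t : Sym) (q r : Prg) : Prg := .branch (fun v => decide (v = some t)) q r
def ifn (q r : Prg) : Prg := .branch (fun v => v.isNone) q r
def out (k : Stack) (t : Sym) (q : Prg) : Prg := .push k (fun _ => t) q
def echo (k : Stack) (q : Prg) : Prg := .push k (fun v => v.getD (.inr false)) q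
def go (l : Lab) : Prg := .goto fun _ => l
def yes : Prg := .load (fun _ => none) .halt
def no : Prg := .load (fun _ => some (.inr false)) .halt
/-- `out` if the flag is set. -/
def outIf (b : Bool) (k : Stack) (t : Sym) (q : Prg) : Prg := cond b (out k t q) q

end Prg

open Prg

local notation "lone" => (Sum.inl Letter.one : Sym)
local notation "lzero" => (Sum.inl Letter.zero : Sym)
local notation "lsep" => (Sum.inl Letter.sep : Sym)

/-- The program; `nx` tells whether `X` is allowed in formulas. -/
def prog (nx : Bool) : Lab → List Prg
  | .readN => [rd .F <| ifs lone (out .NA lone <| out .NB lone <| out .NC lone <| go .readN) <|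
      ifs lsep (go .readM) yes]
  | .readM => [rd .F <| ifs lone (out .M lone <| go .readM) <| ifs lsep (go .rowR) yes]
  | .rowR => [rd .NA <| ifn (go .rowV) <| out .R lsep <| go (.bitR false)]
  | .bitR nz => [rd .NB <| ifn (cond nz (go .backR) yes) <| out .ND lone <| rd .F <|
      ifs lzero (out .R (.inr false) <| go (.bitR nz)) <|
      ifs lone (out .R (.inr true) <| go (.bitR true)) yes]
  | .backR => [rd .ND <| ifn (go .rowR) <| out .NB lone <| go .backR]
  | .rowV => [rd .NC <| ifn (go .readW) <| out .V lsep <| go .bitV]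
  | .bitV => [rd .M <| ifn (go .backV) <| out .MD lone <| rd .F <|
      ifs lzero (out .V (.inr false) <| go .bitV) <|
      ifs lone (out .V (.inr true) <| go .bitV) yes]
  | .backV => [rd .MD <| ifn (go .rowV) <| out .M lone <| go .backV]
  | .readW => [rd .F <| ifs lone (rd .NB <| ifn yes <| out .H (.inr false) <| go .readW) <|
      ifs lsep (rd .NB <| ifn yes <| out .H (.inr true) <| go .padW) yes]
  | .padW => [rd .NB <| ifn (go .clear) <| out .H (.inr false) <| go .padW]
  | .clear => [rd .VR <| ifn (go .pick) <| go .clear]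
  | .pick => [rd .H <| ifn (go .restR) <| ifs (.inr true) (go (.pickR true)) <| go (.pickR false)]
  | .pickR b => [rd .R <| ifs lsep (out .R2 lsep <| go (.pickV b)) <|
      ifn (go (.pickV b)) <| echo .R2 <| cond b (echo .RR <| go (.pickR b)) (go (.pickR b))]
  | .pickV b => [rd .V <| ifs lsep (out .V2 lsep <| go .pick) <|
      ifn (go .pick) <| echo .V2 <| cond b (echo .VR <| go (.pickV b)) (go (.pickV b))]
  | .restR => [rd .R2 <| ifn (go .restV) <| echo .R <| go .restR]
  | .restV => [rd .V2 <| ifn (out .P (.inr false) <| go (.pass false)) <| echo .V <| go .restV]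
  | .pass seen => [rd .F <|
      ifn (rd .P <| ifn (cond seen (go .copy) (go .eval)) yes) <|
      ifs (.inr true) (rd .P <| ifn yes <| out .B (.inr true) <| go (.pass seen)) <|
      ifs (.inr false) (rd .P <| ifn yes <| out .B (.inr false) <| go (.pass seen)) <|
      ifs (.inl .var) (rd .P <| ifs (.inr true) (out .B (.inl .var) <| go (.var true seen)) <|
        ifs (.inr false) (go (.var false seen)) yes) <|
      ifs (.inl .neg) (rd .P <| ifn yes <| echo .P <| out .B (.inl .neg) <| go (.pass seen)) <|
      ifs (.inl .and) (rd .P <| ifn yes <| echo .P <| echo .P <| out .B (.inl .and) <|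
        go (.pass seen)) <|
      ifs (.inl .next) (cond nx (rd .P <|
        ifs (.inr true) (echo .P <| out .B (.inl .next) <| go (.pass seen)) <|
        ifs (.inr false) (out .P (.inr true) <| go (.pass true)) yes) yes) yes]
  | .var b seen => [rd .F <|
      ifs lone (rd .VR <| ifn yes <| echo .VT <| outIf b .B lone <| go (.var b seen)) <|
      ifs lsep (rd .VR <| ifn yes <| echo .VR <| cond b (out .B lsep <| go (.back seen)) <|
        echo .B <| go (.back seen)) yes]
  | .back seen => [rd .VT <| ifn (go (.pass seen)) <| echo .VR <| go (.back seen)]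
  | .eval => [rd .B <| ifn (rd .E <| ifs (.inr false) yes no) <|
      ifs (.inl .neg) (rd .E <| ifs (.inr true) (out .E (.inr false) <| go .eval) <|
        out .E (.inr true) <| go .eval) <|
      ifs (.inl .and) (rd .E <| ifs (.inr true) (go .eval) <|
        rd .E <| out .E (.inr false) <| go .eval) <|
      echo .E <| go .eval]
  | .copy => [rd .B <| ifn (go (.scan false false)) <| echo .F <| go .copy]
  | .scan a b => [rd .RR <| ifn (cond b (go .guess) (go .clear)) <|
      ifs (.inr true) (out .H (.inr true) <| go (.scan true a)) <|
      out .H (.inr false) <| go (.scan a b)]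
  | .guess => [go (.thin true), go (.thin false)]
  | .thin g => [rd .H <| ifn (go (.scan false false)) <|
      ifs (.inr true) (out .RR (.inr g) <| go (.thin !g)) <|
      out .RR (.inr false) <| go (.thin g)]

noncomputable instance : Fintype Letter := Fintype.ofFinite _

/-- The machine. -/
noncomputable def machine (nx : Bool) : NTM Letter where
  K := Stack
  Γ := fun _ => Sym
  k₀ := .F
  input := ⟨Sum.inl, Sum.inl_injective⟩
  Λ := Lab
  main := .readN
  σ := Option Sym
  init := none
  m := prog nx
  accept := {none}

/-- The specification of a label, for every content of the memory. -/
def At (nx : Bool) (l : Lab) (S : Store) (T G : ℕ) (P : Prop) : Prop :=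
  ∀ v : Option Sym, (machine nx).Spec ⟨some l, v, S.get⟩ T G P

variable {nx : Bool} {S : Store} {T G : ℕ} {P : Prop}

theorem At.mono {l : Lab} {T' G' : ℕ} (h : At nx l S T G P) (hT : T ≤ T') (hG : G ≤ G') :
    At nx l S T' G' P := fun v => (h v).mono hT hG

/-- The effect of a statement. -/
def Eff (nx : Bool) (q : Prg) (v : Option Sym) (S : Store) (T G : ℕ) (P : Prop) : Prop :=
  (machine nx).Spec (Turing.TM2.stepAux q v S.get) T G P

/-- Every label is entered with an arbitrary last-read symbol in memory, hence the quantification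
over `v`. -/
theorem At.of_eff {l : Lab} {q : Prg} (hm : prog nx l = [q])
    (h : ∀ v, Eff nx q v S T G P) : At nx l S (T + 1) G P :=
  fun v => NTM.Spec.step (M := machine nx) hm (h v)

/-! ### Symbolic execution of statements -/

section eff

variable {q r : Prg} {v : Option Sym} {k : Stack} {t : Sym}

@[simp] theorem eff_rd :
    Eff nx (rd k q) v S T G P ↔ Eff nx q (S.get k).head? (S.set (S.get k).tail k) T G P := by
  rw [Eff, Eff, ← Store.update_get]; rfl

@[simp] theorem eff_out :
    Eff nx (out k t q) v S T G P ↔ Eff nx q v (S.set (t :: S.get k) k) T G P := by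
  rw [Eff, Eff, ← Store.update_get]; rfl

@[simp] theorem eff_echo :
    Eff nx (echo k q) (some t) S T G P ↔ Eff nx q (some t) (S.set (t :: S.get k) k) T G P := by
  rw [Eff, Eff, ← Store.update_get]; rfl

@[simp] theorem eff_ifs_some {t' : Sym} : Eff nx (ifs t q r) (some t') S T G P ↔
    if t' = t then Eff nx q (some t') S T G P else Eff nx r (some t') S T G P := by
  by_cases h : t' = t <;> simp [Eff, ifs, Turing.TM2.stepAux, h]

@[simp] theorem eff_ifs_none : Eff nx (ifs t q r) none S T G P ↔ Eff nx r none S T G P := by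
  simp [Eff, ifs, Turing.TM2.stepAux]

@[simp] theorem eff_ifn_some : Eff nx (ifn q r) (some t) S T G P ↔ Eff nx r (some t) S T G P := by
  simp [Eff, ifn, Turing.TM2.stepAux]

@[simp] theorem eff_ifn_none : Eff nx (ifn q r) none S T G P ↔ Eff nx q none S T G P := by
  simp [Eff, ifn, Turing.TM2.stepAux]

theorem eff_go {l : Lab} (h : At nx l S T G P) : Eff nx (go l) v S T G P := h v

@[simp] theorem eff_yes : Eff nx yes v S T G P ↔ P := by
  constructor
  · intro h
    exact h.2.1 ⟨0, 0, _, .refl _, rfl, rfl⟩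
  · intro h
    exact NTM.Spec.halt rfl T G (iff_of_true rfl h)

theorem eff_no (h : ¬ P) : Eff nx no v S T G P :=
  NTM.Spec.halt rfl T G (iff_of_false (by rintro ⟨⟩) h)

end eff

theorem At.guess (S : Store) {P₁ P₂ : Prop} (h₁ : At nx (.thin true) S T G P₁)
    (h₂ : At nx (.thin false) S T G P₂) : At nx .guess S (T + 1) (G + 1) (P₁ ∨ P₂) :=
  fun v => NTM.Spec.choice (M := machine nx) rfl (h₁ v) (h₂ v)

/-! ### The header -/

/-- The pattern of all header lemmas: `h` treats input of the expected form, and `hP` is what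
remains to be shown for other input, on which the machine accepts. The three copies of the number
count the rows of the two matrices (`NA`, `NC`) and the entries of an adjacency row (`NB`). -/
theorem readN_spec {L : List Sym}
    (h : ∀ k L', L = List.replicate k lone ++ lsep :: L' →
      At nx .readM { S with F := L', NA := List.replicate k lone ++ S.NA, NB := List.replicate k lone ++ S.NB, NC := List.replicate k lone ++ S.NC } T G P)
    (hP : (∀ k L', L ≠ List.replicate k lone ++ lsep :: L') → P) :
    At nx .readN { S with F := L } (T + L.length + 1) G P := by
  induction L generalizing S with
  | nil => exact .of_eff rfl fun v => by simpa using hP (by simp)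
  | cons a L ih =>
    refine .of_eff rfl fun v => ?_
    simp only [eff_rd, Store.get, Store.set, List.head?_cons, List.tail_cons, eff_ifs_some, eff_out]
    split_ifs with h1 h2
    · subst h1
      refine eff_go (At.mono (ih (S := { S with NA := lone :: S.NA, NB := lone :: S.NB, NC := lone :: S.NC }) ?_ ?_) (by simp +arith) le_rfl)
      · rintro k L' rfl
        simpa [List.replicate_succ', ← List.replicate_succ] using h (k + 1) L' rfl
      · intro hn
        refine hP fun k L' => ?_
        cases k with
        | zero => simp
        | succ k => simpa [List.replicate_succ] using hn k L'
    · subst h2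
      exact eff_go ((h 0 L rfl).mono (by simp) le_rfl)
    · simp
      refine hP fun k L' => ?_
      cases k <;> simp [List.replicate_succ, h1, h2]

theorem readM_spec {L : List Sym}
    (h : ∀ k L', L = List.replicate k lone ++ lsep :: L' →
      At nx .rowR { S with F := L', M := List.replicate k lone ++ S.M } T G P)
    (hP : (∀ k L', L ≠ List.replicate k lone ++ lsep :: L') → P) :
    At nx .readM { S with F := L } (T + L.length + 1) G P := by
  induction L generalizing S with
  | nil => exact .of_eff rfl fun v => by simpa using hP (by simp)
  | cons a L ih =>
    refine .of_eff rfl fun v => ?_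
    simp only [eff_rd, Store.get, Store.set, List.head?_cons, List.tail_cons, eff_ifs_some, eff_out]
    split_ifs with h1 h2
    · subst h1
      refine eff_go (At.mono (ih (S := { S with M := lone :: S.M }) ?_ ?_) (by simp +arith) le_rfl)
      · rintro k L' rfl
        simpa [List.replicate_succ', ← List.replicate_succ] using h (k + 1) L' rfl
      · intro hn
        refine hP fun k L' => ?_
        cases k with
        | zero => simp
        | succ k => simpa [List.replicate_succ] using hn k L'
    · subst h2
      exact eff_go ((h 0 L rfl).mono (by simp) le_rfl)
    · simp
      refine hP fun k L' => ?_
      cases k <;> simp [List.replicate_succ, h1, h2]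

/-- The letter for a truth value, as a stack symbol. -/
def bl (b : Bool) : Sym := if b then lone else lzero

theorem backR_spec {k : ℕ} (h : At nx .rowR { S with ND := [], NB := List.replicate k lone ++ S.NB } T G P) :
    At nx .backR { S with ND := List.replicate k lone } (T + k + 1) G P := by
  induction k generalizing S with
  | zero => exact .of_eff rfl fun v => by simpa using eff_go h
  | succ k ih =>
    refine .of_eff rfl fun v => ?_
    simp [List.replicate_succ]
    refine eff_go (At.mono (ih (S := { S with NB := lone :: S.NB }) ?_) (by omega) le_rfl)
    simpa [List.replicate_succ', ← List.replicate_succ] using h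

theorem backV_spec {k : ℕ} (h : At nx .rowV { S with MD := [], M := List.replicate k lone ++ S.M } T G P) :
    At nx .backV { S with MD := List.replicate k lone } (T + k + 1) G P := by
  induction k generalizing S with
  | zero => exact .of_eff rfl fun v => by simpa using eff_go h
  | succ k ih =>
    refine .of_eff rfl fun v => ?_
    simp [List.replicate_succ]
    refine eff_go (At.mono (ih (S := { S with M := lone :: S.M }) ?_) (by omega) le_rfl)
    simpa [List.replicate_succ', ← List.replicate_succ] using h

/-- The flag `nz` tells whether the row has shown a `one` so far. A row without any contradicts
totality, so the word is no instance. -/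
theorem bitR_spec {L : List Sym} {k : ℕ} {nz : Bool}
    (h : ∀ (r : List Bool) L', r.length = k → (nz = true ∨ true ∈ r) → L = r.map bl ++ L' →
      At nx .backR { S with F := L', NB := [], ND := List.replicate k lone ++ S.ND, R := (r.map Sum.inr).reverse ++ S.R } T G P)
    (hP : (∀ (r : List Bool) L', r.length = k → (nz = true ∨ true ∈ r) → L ≠ r.map bl ++ L') → P) :
    At nx (.bitR nz) { S with F := L, NB := List.replicate k lone } (T + k + 1) G P := by
  induction k generalizing S L nz with
  | zero =>
    refine .of_eff rfl fun v => ?_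
    cases nz
    · simpa using hP (by rintro (_ | _) <;> simp)
    · simpa using eff_go (h [] L rfl (.inl rfl) rfl)
  | succ k ih =>
    refine .of_eff rfl fun v => ?_
    simp [List.replicate_succ]
    cases L with
    | nil =>
      simp
      exact hP fun r L' hr => by cases r <;> simp at hr ⊢
    | cons a L =>
      simp
      split_ifs with h1 h2
      · subst h1
        refine eff_go (At.mono (ih (S := { S with ND := lone :: S.ND, R := .inr false :: S.R }) ?_ ?_)
          (by omega) le_rfl)
        · rintro r L' hr hz rfl
          simpa [List.replicate_succ', ← List.replicate_succ] using
            h (false :: r) L' (by simp [hr]) (by simpa using hz) (by simp [bl])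
        · intro hn
          refine hP fun r L' hr hz => ?_
          rcases r with _ | ⟨_ | _, r⟩
          · simp at hr
          · simpa [bl] using hn r L' (by simpa using hr) (by simpa using hz)
          · simp [bl]
      · subst h2
        refine eff_go (At.mono (ih (S := { S with ND := lone :: S.ND, R := .inr true :: S.R }) ?_ ?_)
          (by omega) le_rfl)
        · rintro r L' hr hz rfl
          simpa [List.replicate_succ', ← List.replicate_succ] using
            h (true :: r) L' (by simp [hr]) (by simp) (by simp [bl])
        · intro hn
          refine hP fun r L' hr hz => ?_
          rcases r with _ | ⟨_ | _, r⟩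
          · simp at hr
          · simp [bl]
          · simpa [bl] using hn r L' (by simpa using hr) (by simp)
      · refine hP fun r L' hr _ => ?_
        rcases r with _ | ⟨_ | _, r⟩
        · simp at hr
        · simp [bl, h1]
        · simp [bl, h2]

theorem bitV_spec {L : List Sym} {k : ℕ}
    (h : ∀ (r : List Bool) L', r.length = k → L = r.map bl ++ L' →
      At nx .backV { S with F := L', M := [], MD := List.replicate k lone ++ S.MD, V := (r.map Sum.inr).reverse ++ S.V } T G P)
    (hP : (∀ (r : List Bool) L', r.length = k → L ≠ r.map bl ++ L') → P) :
    At nx .bitV { S with F := L, M := List.replicate k lone } (T + k + 1) G P := by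
  induction k generalizing S L with
  | zero =>
    refine .of_eff rfl fun v => ?_
    simpa using eff_go (h [] L rfl rfl)
  | succ k ih =>
    refine .of_eff rfl fun v => ?_
    simp [List.replicate_succ]
    cases L with
    | nil =>
      simp
      exact hP fun r L' hr => by cases r <;> simp at hr ⊢
    | cons a L =>
      simp
      split_ifs with h1 h2
      · subst h1
        refine eff_go (At.mono (ih (S := { S with MD := lone :: S.MD, V := .inr false :: S.V }) ?_ ?_)
          (by omega) le_rfl)
        · rintro r L' hr rfl
          simpa [List.replicate_succ', ← List.replicate_succ] using
            h (false :: r) L' (by simp [hr]) (by simp [bl])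
        · intro hn
          refine hP fun r L' hr => ?_
          rcases r with _ | ⟨_ | _, r⟩
          · simp at hr
          · simpa [bl] using hn r L' (by simpa using hr)
          · simp [bl]
      · subst h2
        refine eff_go (At.mono (ih (S := { S with MD := lone :: S.MD, V := .inr true :: S.V }) ?_ ?_)
          (by omega) le_rfl)
        · rintro r L' hr rfl
          simpa [List.replicate_succ', ← List.replicate_succ] using
            h (true :: r) L' (by simp [hr]) (by simp [bl])
        · intro hn
          refine hP fun r L' hr => ?_
          rcases r with _ | ⟨_ | _, r⟩
          · simp at hr
          · simp [bl]
          · simpa [bl] using hn r L' (by simpa using hr)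
      · refine hP fun r L' hr => ?_
        rcases r with _ | ⟨_ | _, r⟩
        · simp at hr
        · simp [bl, h1]
        · simp [bl, h2]

/-- A matrix row as stored on a stack: last entry on top, a separator below. -/
def stkRow (r : List Bool) : List Sym := (r.map Sum.inr).reverse ++ [lsep]

/-- The cost 2n + 3 of a row is one step at the row label, n + 1 for reading the entries and n + 1
for refilling the counter `NB` from `ND`. -/
theorem rowR_spec {L : List Sym} {k n : ℕ}
    (h : ∀ (rows : List (List Bool)) L', rows.length = k → (∀ r ∈ rows, r.length = n ∧ true ∈ r) →
      L = rows.flatten.map bl ++ L' →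
      At nx .rowV { S with F := L', NA := [], NB := List.replicate n lone, ND := [], R := rows.reverse.flatMap stkRow ++ S.R } T G P)
    (hP : (∀ (rows : List (List Bool)) L', rows.length = k → (∀ r ∈ rows, r.length = n ∧ true ∈ r) →
      L ≠ rows.flatten.map bl ++ L') → P) :
    At nx .rowR { S with F := L, NA := List.replicate k lone, NB := List.replicate n lone, ND := [] }
      (T + k * (2 * n + 3) + 1) G P := by
  induction k generalizing S L with
  | zero =>
    refine .of_eff rfl fun v => ?_
    simpa using eff_go (h [] L rfl (by simp) rfl)
  | succ k ih =>
    refine .of_eff rfl fun v => ?_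
    simp [List.replicate_succ]
    refine eff_go (At.mono (bitR_spec (T := T + k * (2 * n + 3) + 1 + n + 1) (nz := false)
      (S := { S with NA := List.replicate k lone, ND := [], R := lsep :: S.R }) ?_ ?_)
      (by linarith) le_rfl)
    · rintro r L' hr hz rfl
      have := backR_spec (nx := nx) (T := T + k * (2 * n + 3) + 1) (G := G) (P := P) (k := n)
        (S := { S with F := L', NA := List.replicate k lone, NB := [], R := (r.map Sum.inr).reverse ++ lsep :: S.R })
      simp only [List.append_nil] at this ⊢
      refine this (ih (S := { S with R := (r.map Sum.inr).reverse ++ lsep :: S.R }) ?_ ?_)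
      · rintro rows L'' hk hrows rfl
        simpa [stkRow] using h (r :: rows) L'' (by simp [hk])
          (by simpa [hr] using ⟨by simpa using hz, hrows⟩) (by simp)
      · intro hn
        refine hP fun rows L'' hk hrows => ?_
        rcases rows with _ | ⟨r', rows⟩
        · simp at hk
        · intro he
          simp at hrows hk
          simp only [List.flatten_cons, List.map_append, List.append_assoc] at he
          obtain ⟨-, he⟩ := List.append_inj he (by simp [hr, hrows.1.1])
          exact hn rows L'' hk hrows.2 he
    · intro hn
      refine hP fun rows L'' hk hrows he => ?_
      rcases rows with _ | ⟨r', rows⟩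
      · simp at hk
      · simp at hrows
        exact hn r' (rows.flatten.map bl ++ L'') hrows.1.1 (by simp [hrows.1.2]) (by simpa using he)

theorem rowV_spec {L : List Sym} {k n : ℕ}
    (h : ∀ (rows : List (List Bool)) L', rows.length = k → (∀ r ∈ rows, r.length = n) →
      L = rows.flatten.map bl ++ L' →
      At nx .readW { S with F := L', NC := [], M := List.replicate n lone, MD := [], V := rows.reverse.flatMap stkRow ++ S.V } T G P)
    (hP : (∀ (rows : List (List Bool)) L', rows.length = k → (∀ r ∈ rows, r.length = n) →
      L ≠ rows.flatten.map bl ++ L') → P) :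
    At nx .rowV { S with F := L, NC := List.replicate k lone, M := List.replicate n lone, MD := [] }
      (T + k * (2 * n + 3) + 1) G P := by
  induction k generalizing S L with
  | zero =>
    refine .of_eff rfl fun v => ?_
    simpa using eff_go (h [] L rfl (by simp) rfl)
  | succ k ih =>
    refine .of_eff rfl fun v => ?_
    simp [List.replicate_succ]
    refine eff_go (At.mono (bitV_spec (T := T + k * (2 * n + 3) + 1 + n + 1)
      (S := { S with NC := List.replicate k lone, MD := [], V := lsep :: S.V }) ?_ ?_)
      (by linarith) le_rfl)
    · rintro r L' hr rfl
      have := backV_spec (nx := nx) (T := T + k * (2 * n + 3) + 1) (G := G) (P := P) (k := n)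
        (S := { S with F := L', NC := List.replicate k lone, M := [], V := (r.map Sum.inr).reverse ++ lsep :: S.V })
      simp only [List.append_nil] at this ⊢
      refine this (ih (S := { S with V := (r.map Sum.inr).reverse ++ lsep :: S.V }) ?_ ?_)
      · rintro rows L'' hk hrows rfl
        simpa [stkRow] using h (r :: rows) L'' (by simp [hk])
          (by simpa [hr] using hrows) (by simp)
      · intro hn
        refine hP fun rows L'' hk hrows => ?_
        rcases rows with _ | ⟨r', rows⟩
        · simp at hk
        · intro he
          simp at hrows hk
          simp only [List.flatten_cons, List.map_append, List.append_assoc] at he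
          obtain ⟨-, he⟩ := List.append_inj he (by simp [hr, hrows.1])
          exact hn rows L'' hk hrows.2 he
    · intro hn
      refine hP fun rows L'' hk hrows he => ?_
      rcases rows with _ | ⟨r', rows⟩
      · simp at hk
      · simp at hrows
        exact hn r' (rows.flatten.map bl ++ L'') hrows.1 (by simpa using he)

theorem padW_spec {k : ℕ}
    (h : At nx .clear { S with NB := [], H := List.replicate k (.inr false) ++ S.H } T G P) :
    At nx .padW { S with NB := List.replicate k lone } (T + k + 1) G P := by
  induction k generalizing S with
  | zero => exact .of_eff rfl fun v => by simpa using eff_go h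
  | succ k ih =>
    refine .of_eff rfl fun v => ?_
    simp [List.replicate_succ]
    refine eff_go (At.mono (ih (S := { S with H := .inr false :: S.H }) ?_) (by omega) le_rfl)
    simpa [List.replicate_succ', ← List.replicate_succ] using h

/-- Every `one` uses up a unit of `NB`, so an index that is too large empties the counter. What is
left of the counter after the separator pads the indicator vector of the world to full length. -/
theorem readW_spec {L : List Sym} {k : ℕ}
    (h : ∀ w L', w < k → L = List.replicate w lone ++ lsep :: L' →
      At nx .clear { S with F := L', NB := [], H := List.replicate (k - 1 - w) (.inr false) ++ .inr true :: (List.replicate w (.inr false) ++ S.H) } T G P)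
    (hP : (∀ w L', w < k → L ≠ List.replicate w lone ++ lsep :: L') → P) :
    At nx .readW { S with F := L, NB := List.replicate k lone } (T + k + 1) G P := by
  induction k generalizing S L with
  | zero =>
    refine .of_eff rfl fun v => ?_
    cases L with
    | nil => simpa using hP
    | cons a L =>
      simp only [eff_rd, Store.get, Store.set, List.head?_cons, List.tail_cons, eff_ifs_some]
      split_ifs <;> simpa using hP (by simp)
  | succ k ih =>
    refine .of_eff rfl fun v => ?_
    cases L with
    | nil => simpa using hP
    | cons a L =>
      simp only [eff_rd, Store.get, Store.set, List.head?_cons, List.tail_cons, eff_ifs_some,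
        List.replicate_succ, eff_ifn_some, eff_out]
      split_ifs with h1 h2
      · subst h1
        refine eff_go (At.mono (ih (S := { S with H := .inr false :: S.H }) ?_ ?_)
          (by omega) le_rfl)
        · rintro w L' hw rfl
          have := h (w + 1) L' (by omega) rfl
          simpa [List.replicate_succ', ← List.replicate_succ, show k - (w + 1) = k - 1 - w by omega]
            using this
        · intro hn
          refine hP fun w L' hw => ?_
          cases w with
          | zero => simp
          | succ w => simpa [List.replicate_succ] using hn w L' (by omega)
      · subst h2
        refine eff_go (At.mono (padW_spec (T := T) (S := { S with F := L, H := .inr true :: S.H }) ?_)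
          (by omega) le_rfl)
        simpa using h 0 L (by omega) rfl
      · simp
        refine hP fun w L' _ => ?_
        cases w <;> simp [List.replicate_succ, h1, h2]

theorem replicate_lsep_inj {a b : ℕ} {s t : List Sym}
    (h : List.replicate a lone ++ lsep :: s = List.replicate b lone ++ lsep :: t) :
    a = b ∧ s = t := by
  induction a generalizing b with
  | zero => cases b <;> simp_all [List.replicate_succ]
  | succ a ih =>
    cases b with
    | zero => simp [List.replicate_succ] at h
    | succ b =>
      simp only [List.replicate_succ, List.cons_append, List.cons.injEq, true_and] at h
      simpa using ih h

/-! ### Formulas with constants, and one progression step -/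

/-- Formulas with `X` as the only temporal operator (without temporal operators if `nx` is
`false`), and with constants. -/
inductive Fm (m : ℕ) (nx : Bool) : Type
  | tt : Bool → Fm m nx
  | var : Fin m → Fm m nx
  | neg : Fm m nx → Fm m nx
  | and : Fm m nx → Fm m nx → Fm m nx
  | next : nx = true → Fm m nx → Fm m nx

namespace Fm

variable {m : ℕ}

/-- Prefix notation. -/
def toks : Fm m nx → List Sym
  | tt b => [.inr b]
  | var i => .inl .var :: (List.replicate i lone ++ [lsep])
  | neg φ => .inl .neg :: φ.toks
  | and φ ψ => .inl .and :: (φ.toks ++ ψ.toks)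
  | next _ φ => .inl .next :: φ.toks

/-- Temporal depth. -/
def td : Fm m nx → ℕ
  | tt _ => 0
  | var _ => 0
  | neg φ => φ.td
  | and φ ψ => max φ.td ψ.td
  | next _ φ => φ.td + 1

/-- Outside of the scope of `X` replace the propositions by their values and delete the outermost
`X`; the flag tells whether the formula is in the scope of an `X`. -/
def fwd (v : Fin m → Bool) : Bool → Fm m nx → Fm m nx
  | _, tt c => tt c
  | b, var i => if b then var i else tt (v i)
  | b, neg φ => neg (φ.fwd v b)
  | b, and φ ψ => and (φ.fwd v b) (ψ.fwd v b)
  | b, next h φ => if b then next h (φ.fwd v true) else φ.fwd v true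

/-- The value of a formula without `X`. -/
def val (v : Fin m → Bool) : Fm m nx → Bool
  | tt c => c
  | var i => v i
  | neg φ => !(φ.val v)
  | and φ ψ => φ.val v && ψ.val v
  | next _ _ => false

theorem fwd_true (v : Fin m → Bool) (φ : Fm m nx) : φ.fwd v true = φ := by
  induction φ <;> simp_all [fwd]

/-- Every outermost `X` disappears and nothing below it changes. Truncated subtraction covers depth
zero. -/
theorem td_fwd (v : Fin m → Bool) (φ : Fm m nx) : (φ.fwd v false).td = φ.td - 1 := by
  induction φ <;> simp_all [fwd, td, fwd_true]
  omega

/-- A proposition shrinks to one symbol and an outermost `X` is deleted, so one length bound serves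
for all rounds. -/
theorem length_toks_fwd (v : Fin m → Bool) (b : Bool) (φ : Fm m nx) :
    (φ.fwd v b).toks.length ≤ φ.toks.length := by
  induction φ generalizing b with
  | tt => simp [fwd]
  | var i => cases b <;> simp [fwd, toks]
  | neg φ ih => simpa [fwd, toks] using ih b
  | and φ ψ ih₁ ih₂ =>
    have := ih₁ b
    have := ih₂ b
    simp [fwd, toks]
    omega
  | next h φ ih => cases b <;> simp [fwd, toks, fwd_true]

/-- Unique readability: the formula that a pass recognises is the one that the invariant speaks of.
-/
theorem toks_inj : ∀ (φ ψ : Fm m nx) (s t : List Sym),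
    φ.toks ++ s = ψ.toks ++ t → φ = ψ ∧ s = t := by
  intro φ
  induction φ with
  | tt c => intro ψ s t h; cases ψ <;> simp_all [toks]
  | var i =>
    intro ψ s t h
    cases ψ <;> simp [toks] at h
    rename_i j
    obtain ⟨h1, h2⟩ := replicate_lsep_inj h
    exact ⟨by rw [Fin.ext h1], h2⟩
  | neg φ ih =>
    intro ψ s t h
    cases ψ <;> simp [toks] at h
    obtain ⟨h1, h2⟩ := ih _ _ _ h
    exact ⟨by rw [h1], h2⟩
  | and φ₁ φ₂ ih₁ ih₂ =>
    intro ψ s t h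
    cases ψ <;> simp [toks] at h
    obtain ⟨h1, h2⟩ := ih₁ _ _ _ h
    obtain ⟨h3, h4⟩ := ih₂ _ _ _ h2
    exact ⟨by rw [h1, h3], h4⟩
  | next h' φ ih =>
    intro ψ s t h
    cases ψ <;> simp [toks] at h
    obtain ⟨h1, h2⟩ := ih _ _ _ h
    exact ⟨by rw [h1], h2⟩

end Fm

/-! ### Looking up a proposition -/

theorem back_spec {seen : Bool} {l : List Sym}
    (h : At nx (.pass seen) { S with VT := [], VR := l.reverse ++ S.VR } T G P) :
    At nx (.back seen) { S with VT := l } (T + l.length + 1) G P := by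
  induction l generalizing S with
  | nil => exact .of_eff rfl fun v => by simpa using eff_go h
  | cons a l ih =>
    refine .of_eff rfl fun v => ?_
    simp
    refine eff_go (At.mono (ih (S := { S with VR := a :: S.VR }) ?_) (by omega) le_rfl)
    simpa using h

/-- Each `one` moves an entry from `VR` to `VT`, so at the separator the value of the proposition is
on top of `VR`, and an index out of range runs into the empty stack. In the scope of an `X` the walk
serves only as this check. The way back through `VT` is the reason for the factor 2 and for the
summand `vs₁.length`. -/
theorem var_spec {b seen : Bool} {vs₁ vs₂ : List Bool} {L : List Sym}
    (h : ∀ i L' c, vs₂[i]? = some c → L = List.replicate i lone ++ lsep :: L' →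
      At nx (.pass seen) { S with F := L', VR := (vs₁ ++ vs₂).map .inr, VT := [], B := (if b then lsep :: List.replicate i lone else [.inr c]) ++ S.B } (T + 2 * L'.length) G P)
    (hP : (∀ i L', i < vs₂.length → L ≠ List.replicate i lone ++ lsep :: L') → P) :
    At nx (.var b seen) { S with F := L, VR := vs₂.map .inr, VT := (vs₁.map .inr).reverse }
      (T + 2 * L.length + vs₁.length + 1) G P := by
  induction L generalizing S vs₁ vs₂ with
  | nil => exact .of_eff rfl fun v => by simpa using hP (by simp)
  | cons a L ih =>
    refine .of_eff rfl fun v => ?_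
    simp only [eff_rd, Store.get, Store.set, List.head?_cons, List.tail_cons, eff_ifs_some]
    cases vs₂ with
    | nil =>
      have : P := hP (by simp)
      split_ifs <;> simpa
    | cons c vs₂ =>
      split_ifs with h1 h2
      · subst h1
        simp only [List.map_cons, List.head?_cons, eff_ifn_some, eff_echo, Store.set, Store.get,
          List.tail_cons]
        have hP' : (∀ i L', i < vs₂.length → L ≠ List.replicate i lone ++ lsep :: L') → P := by
          intro hn
          refine hP fun i L' hi => ?_
          cases i with
          | zero => simp
          | succ i => simpa [List.replicate_succ] using hn i L' (by simpa using hi)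
        cases b with
        | false =>
          have := ih (S := S) (vs₁ := vs₁ ++ [c]) (vs₂ := vs₂) (fun i L' c' hc hL => by
            simpa using h (i + 1) L' c' (by simpa using hc) (by rw [hL]; rfl)) hP'
          exact eff_go (At.mono (by simpa using this) (by simp +arith) le_rfl)
        | true =>
          have := ih (S := { S with B := lone :: S.B }) (vs₁ := vs₁ ++ [c]) (vs₂ := vs₂)
            (fun i L' c' hc hL => by
              simpa [List.replicate_succ', ← List.replicate_succ] using
                h (i + 1) L' c' (by simpa using hc) (by rw [hL]; rfl)) hP'
          exact eff_out.2 (eff_go (At.mono (by simpa using this) (by simp +arith) le_rfl))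
      · subst h2
        have := h 0 L c (by simp) rfl
        cases b <;> simp
        · refine eff_go (At.mono (back_spec (S := { S with F := L, VR := .inr c :: vs₂.map .inr, B := .inr c :: S.B }) (T := T + 2 * L.length) ?_) (by simp +arith) le_rfl)
          simpa using this
        · refine eff_go (At.mono (back_spec (S := { S with F := L, VR := .inr c :: vs₂.map .inr, B := lsep :: S.B }) (T := T + 2 * L.length) ?_) (by simp +arith) le_rfl)
          simpa using this
      · simp
        refine hP fun i L' _ => ?_
        cases i <;> simp [List.replicate_succ, h1, h2]

/-! ### Moving and clearing stacks between passes -/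

theorem copy_spec {l : List Sym}
    (h : At nx (.scan false false) { S with B := [], F := l.reverse ++ S.F } T G P) :
    At nx .copy { S with B := l } (T + l.length + 1) G P := by
  induction l generalizing S with
  | nil => exact .of_eff rfl fun v => by simpa using eff_go h
  | cons a l ih =>
    refine .of_eff rfl fun v => ?_
    simp
    refine eff_go (At.mono (ih (S := { S with F := a :: S.F }) ?_) (by omega) le_rfl)
    simpa using h

theorem clear_spec {l : List Sym} (h : At nx .pick { S with VR := [] } T G P) :
    At nx .clear { S with VR := l } (T + l.length + 1) G P := by
  induction l generalizing S with
  | nil => exact .of_eff rfl fun v => by simpa using eff_go h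
  | cons a l ih =>
    refine .of_eff rfl fun v => ?_
    simp
    exact eff_go (At.mono (ih h) (by omega) le_rfl)

theorem restV_spec {l : List Sym}
    (h : At nx (.pass false) { S with V2 := [], V := l.reverse ++ S.V, P := .inr false :: S.P } T G P) :
    At nx .restV { S with V2 := l } (T + l.length + 1) G P := by
  induction l generalizing S with
  | nil => exact .of_eff rfl fun v => by simpa using eff_go h
  | cons a l ih =>
    refine .of_eff rfl fun v => ?_
    simp
    refine eff_go (At.mono (ih (S := { S with V := a :: S.V }) ?_) (by omega) le_rfl)
    simpa using h

theorem restR_spec {l : List Sym}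
    (h : At nx .restV { S with R2 := [], R := l.reverse ++ S.R } T G P) :
    At nx .restR { S with R2 := l } (T + l.length + 1) G P := by
  induction l generalizing S with
  | nil => exact .of_eff rfl fun v => by simpa using eff_go h
  | cons a l ih =>
    refine .of_eff rfl fun v => ?_
    simp
    refine eff_go (At.mono (ih (S := { S with R := a :: S.R }) ?_) (by omega) le_rfl)
    simpa using h

/-! ### A pass over the formula -/

/-- The output of a pass over the formulas in the list `φs` with flags `ps`. -/
def passOut {m : ℕ} (v : Fin m → Bool) : List Bool → List (Fm m nx) → List Sym
  | b :: ps, φ :: φs => (φ.fwd v b).toks ++ passOut v ps φs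
  | _, _ => []

/-- Does a pass meet an outermost `X`? -/
def passSeen {m : ℕ} : List Bool → List (Fm m nx) → Bool
  | b :: ps, φ :: φs => (!b && φ.td != 0) || passSeen ps φs
  | _, _ => false

theorem Fm.exists_cons_toks {m : ℕ} (φ : Fm m nx) : ∃ a L, φ.toks = a :: L := by
  cases φ <;> exact ⟨_, _, rfl⟩

theorem max_ne_zero (a b : ℕ) : (max a b != 0) = (a != 0 || b != 0) := by
  cases a <;> cases b <;> simp

-- `P` holds one flag for each formula still to be read: in prefix notation an operator replaces the
-- top flag by one flag for each of its arguments. So the rest of the input has to be a list of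
-- `ps.length` formulas. The induction on the length is strong because a proposition uses up several
-- symbols at once.
set_option maxHeartbeats 1000000 in
theorem pass_spec {m : ℕ} {v : Fin m → Bool} {vs : List Bool} (hvs : vs = List.ofFn v) {L : List Sym} {ps : List Bool} {seen : Bool}
    (h : ∀ φs : List (Fm m nx), φs.length = ps.length → L = φs.flatMap Fm.toks →
      At nx (.pass (seen || passSeen ps φs)) { S with F := [], P := [], B := (passOut v ps φs).reverse ++ S.B, VR := vs.map .inr, VT := [] } T G P)
    (hP : (∀ φs : List (Fm m nx), φs.length = ps.length → L ≠ φs.flatMap Fm.toks) → P) :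
    At nx (.pass seen) { S with F := L, P := ps.map .inr, VR := vs.map .inr, VT := [] }
      (T + 2 * L.length + 1) G P := by
  induction hn : L.length using Nat.strong_induction_on generalizing L S ps seen with
  | _ n ih =>
  subst hn
  rcases L with _ | ⟨a, L⟩
  · rcases ps with _ | ⟨b, ps⟩
    · have := h [] rfl rfl
      simp [passOut, passSeen] at this
      exact this.mono (by omega) le_rfl
    · refine .of_eff rfl fun _ => ?_
      simp
      refine hP fun φs hl => ?_
      rcases φs with _ | ⟨φ, φs⟩
      · simp at hl
      · obtain ⟨a, L, he⟩ := φ.exists_cons_toks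
        simp [he]
  · refine .of_eff rfl fun _ => ?_
    rcases ps with _ | ⟨b, ps⟩
    · have : P := hP fun φs hl => by simp_all
      simp only [eff_rd, Store.get, Store.set, List.head?_cons, List.tail_cons, eff_ifn_some,
        eff_ifs_some]
      cases nx <;> split_ifs <;> simpa
    · have hne : ∀ φs : List (Fm m nx), φs.length = (b :: ps).length →
          ∃ φ φs', φs = φ :: φs' ∧ φs'.length = ps.length := by
        rintro (_ | ⟨φ, φs⟩) hl
        · simp at hl
        · exact ⟨φ, φs, rfl, by simpa using hl⟩
      -- For symbols that cannot begin a formula, where the machine accepts immediately.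
      have hbad : (∀ φ : Fm m nx, ∀ L', φ.toks ≠ a :: L') → P := by
        intro hbad
        refine hP fun φs hl he => ?_
        obtain ⟨φ, φs', rfl, -⟩ := hne φs hl
        obtain ⟨a', L', h'⟩ := φ.exists_cons_toks
        simp [h'] at he
        exact hbad φ L' (by rw [h', he.1])
      rcases a with a | c
      · cases a
        case var =>
          have hv : ∀ B', (∀ i L' c, vs[i]? = some c → L = List.replicate i lone ++ lsep :: L' →
              At nx (.pass seen) { S with F := L', P := ps.map .inr, VR := vs.map .inr, VT := [], B := (if b then lsep :: List.replicate i lone else [.inr c]) ++ B' } (T + 1 + 2 * L'.length) G P) →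
              At nx (.var b seen) { S with F := L, P := ps.map .inr, VR := vs.map .inr, VT := [], B := B' } (T + 1 + 2 * L.length + 1) G P := by
            intro B' hB
            have := var_spec (nx := nx) (S := { S with P := ps.map .inr, B := B' }) (vs₁ := []) (b := b)
              (T := T + 1) (G := G) (P := P) (seen := seen) hB (fun hn => by
                refine hP fun φs hl he => ?_
                obtain ⟨φ, φs', rfl, -⟩ := hne φs hl
                cases φ <;> simp [Fm.toks] at he
                rename_i i
                exact hn i _ (by simp [hvs]) he)
            simpa using this
          have key : ∀ (i : ℕ) (L' : List Sym) (c : Bool), vs[i]? = some c →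
              L = List.replicate i lone ++ lsep :: L' →
              At nx (.pass seen) { S with F := L', P := ps.map .inr, VR := vs.map .inr, VT := [], B := (if b then lsep :: (List.replicate i lone ++ [.inl .var]) else [.inr c]) ++ S.B } (T + 1 + 2 * L'.length) G P := by
            rintro i L' c hc rfl
            rw [hvs] at hc
            obtain ⟨hi, rfl⟩ := List.getElem?_eq_some_iff.1 hc
            simp at hi
            rw [List.getElem_ofFn]
            refine At.mono (T := T + 2 * L'.length + 1) (G := G) ?_ (by omega) le_rfl
            refine ih _ (by simp; omega) (S := { S with B := (if b then lsep :: (List.replicate i lone ++ [.inl .var]) else [.inr (v ⟨i, hi⟩)]) ++ S.B })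
              (ps := ps) (seen := seen) ?_ ?_ rfl
            · rintro φs hl rfl
              have := h (.var ⟨i, hi⟩ :: φs) (by simp [hl]) (by simp [Fm.toks])
              cases b <;> simpa [passOut, passSeen, Fm.fwd, Fm.toks, Fm.td] using this
            · intro hn
              refine hP fun φs hl he => ?_
              obtain ⟨φ, φs', rfl, hl'⟩ := hne φs hl
              refine hn φs' hl' ?_
              have h1 : Fm.toks (.var ⟨i, hi⟩ : Fm m nx) ++ L' = φ.toks ++ φs'.flatMap Fm.toks := by
                simpa [Fm.toks] using he
              exact (Fm.toks_inj _ _ _ _ h1).2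
          cases b
          · simp
            refine eff_go (At.mono (hv S.B ?_) (by omega) le_rfl)
            intro i L' c hc he
            simpa using key i L' c hc he
          · simp
            refine eff_go (At.mono (hv (.inl .var :: S.B) ?_) (by omega) le_rfl)
            intro i L' c hc he
            simpa using key i L' c hc he
        case neg =>
          simp
          refine eff_go (At.mono (ih L.length (by simp) (S := { S with B := .inl .neg :: S.B })
            (ps := b :: ps) (seen := seen) ?_ ?_ rfl) (by omega) le_rfl)
          · rintro φs hl rfl
            obtain ⟨φ, φs', rfl, hl'⟩ := hne φs hl
            have := h (.neg φ :: φs') (by simp [hl']) (by simp [Fm.toks])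
            simpa [passOut, passSeen, Fm.fwd, Fm.toks, Fm.td] using this
          · intro hn
            refine hP fun φs hl he => ?_
            obtain ⟨φ, φs', rfl, hl'⟩ := hne φs hl
            cases φ <;> simp [Fm.toks] at he
            rename_i φ
            exact hn (φ :: φs') (by simp [hl']) (by simpa using he)
        case and =>
          simp
          refine eff_go (At.mono (ih L.length (by simp) (S := { S with B := .inl .and :: S.B })
            (ps := b :: b :: ps) (seen := seen) ?_ ?_ rfl) (by omega) le_rfl)
          · rintro φs hl rfl
            obtain _ | ⟨φ, _ | ⟨ψ, φs⟩⟩ := φs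
            · simp at hl
            · simp at hl
            simp at hl
            have := h (.and φ ψ :: φs) (by simp [hl]) (by simp [Fm.toks])
            cases b <;>
              simpa [passOut, passSeen, Fm.fwd, Fm.toks, Fm.td, max_ne_zero, Bool.or_assoc] using this
          · intro hn
            refine hP fun φs hl he => ?_
            obtain ⟨φ, φs', rfl, hl'⟩ := hne φs hl
            cases φ <;> simp [Fm.toks] at he
            rename_i φ ψ
            exact hn (φ :: ψ :: φs') (by simp [hl']) (by simpa using he)
        case next =>
          -- If `X` is not allowed, `Fm.next` would need a proof of `false = true`, so no formula
          -- begins with this symbol.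
          cases hnx : nx with
          | false =>
            subst hnx
            have : P := hbad fun φ => by
              cases φ with
              | next h' _ => cases h'
              | _ => simp [Fm.toks]
            simpa
          | true =>
            have hn' : (∀ φs : List (Fm m nx), φs.length = (true :: ps).length →
                L ≠ φs.flatMap Fm.toks) → P := by
              intro hn
              refine hP fun φs hl he => ?_
              obtain ⟨φ, φs', rfl, hl'⟩ := hne φs hl
              cases φ <;> simp [Fm.toks] at he
              rename_i φ
              exact hn (φ :: φs') (by simp [hl']) (by simpa using he)
            subst hnx
            cases b with
            | false =>
              simp
              -- An outermost `X`: nothing is written to `B`, the argument is read with flag `true`,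
              -- and `seen` is set.
              refine eff_go (At.mono (ih L.length (by simp) (S := S)
                (ps := true :: ps) (seen := true) ?_ hn' rfl) (by omega) le_rfl)
              rintro φs hl rfl
              obtain ⟨φ, φs', rfl, hl'⟩ := hne φs hl
              have := h (.next rfl φ :: φs') (by simp [hl']) (by simp [Fm.toks])
              simpa [passOut, passSeen, Fm.fwd, Fm.toks, Fm.td] using this
            | true =>
              simp
              refine eff_go (At.mono (ih L.length (by simp) (S := { S with B := .inl .next :: S.B })
                (ps := true :: ps) (seen := seen) ?_ hn' rfl) (by omega) le_rfl)
              rintro φs hl rfl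
              obtain ⟨φ, φs', rfl, hl'⟩ := hne φs hl
              have := h (.next rfl φ :: φs') (by simp [hl']) (by simp [Fm.toks])
              simpa [passOut, passSeen, Fm.fwd, Fm.toks, Fm.td] using this
        all_goals
          have : P := hbad fun φ => by cases φ <;> simp [Fm.toks]
          simpa
      · have key : At nx (.pass seen) { S with F := L, P := ps.map .inr, VR := vs.map .inr, VT := [], B := .inr c :: S.B } (T + 2 * L.length + 1) G P := by
          refine ih L.length (by simp) (S := { S with B := .inr c :: S.B })
            (ps := ps) (seen := seen) ?_ ?_ rfl
          · rintro φs hl rfl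
            have := h (.tt c :: φs) (by simp [hl]) (by simp [Fm.toks])
            simpa [passOut, passSeen, Fm.fwd, Fm.toks, Fm.td] using this
          · intro hn
            refine hP fun φs hl he => ?_
            obtain ⟨φ, φs', rfl, hl'⟩ := hne φs hl
            cases φ <;> simp [Fm.toks] at he
            exact hn φs' hl' he.2
        cases c <;> simp <;> exact eff_go (key.mono (by omega) le_rfl)

/-! ### Evaluation -/

/-- `B` holds the formula with its last symbol on top. Prefix notation read from the right is
postfix notation, which is evaluated with the operand stack `E`. -/
theorem eval_spec {m : ℕ} (v : Fin m → Bool) (φ : Fm m nx) (hφ : φ.td = 0)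
    (h : At nx .eval { S with E := .inr (φ.val v) :: S.E } T G P) :
    At nx .eval { S with B := (φ.fwd v false).toks.reverse ++ S.B }
      (T + (φ.fwd v false).toks.length) G P := by
  induction φ generalizing S T with
  | tt c =>
    refine .of_eff rfl fun _ => ?_
    simp [Fm.fwd, Fm.toks]
    exact eff_go h
  | var i =>
    refine .of_eff rfl fun _ => ?_
    simp [Fm.fwd, Fm.toks]
    exact eff_go h
  | neg φ ih =>
    have key : At nx .eval { S with B := .inl .neg :: S.B, E := .inr (φ.val v) :: S.E } (T + 1) G P := by
      refine .of_eff rfl fun _ => ?_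
      simp only [Fm.val] at h
      cases hv : φ.val v <;> rw [hv] at h <;> simp <;> exact eff_go h
    have := ih hφ (S := { S with B := .inl .neg :: S.B }) key
    simp [Fm.fwd, Fm.toks]
    exact this.mono (by omega) le_rfl
  | and φ ψ ih₁ ih₂ =>
    simp [Fm.td] at hφ
    have key : At nx .eval { S with B := .inl .and :: S.B, E := .inr (φ.val v) :: .inr (ψ.val v) :: S.E } (T + 1) G P := by
      refine .of_eff rfl fun _ => ?_
      simp only [Fm.val] at h
      cases hv : φ.val v <;> rw [hv] at h <;> simp <;> exact eff_go (by simpa using h)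
    -- Backwards from the operator: the left conjunct is read just before it, the right conjunct
    -- before that.
    have h1 := ih₁ hφ.1 (S := { S with B := .inl .and :: S.B, E := .inr (ψ.val v) :: S.E }) key
    have h2 := ih₂ hφ.2 (S := { S with B := (φ.fwd v false).toks.reverse ++ .inl .and :: S.B }) h1
    simp [Fm.fwd, Fm.toks]
    exact h2.mono (by omega) le_rfl
  | next _ φ => simp [Fm.td] at hφ

theorem eval_end {c : Bool} {l : List Sym} :
    At nx .eval { S with B := [], E := .inr c :: l } (T + 1) G (c = false) := by
  refine .of_eff rfl fun _ => ?_
  cases c <;> simp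
  exact eff_no (by simp)

/-! ### Selection of a row -/

theorem pickR_spec {b : Bool} {r : List Bool} {L : List Sym}
    (h : At nx (.pickV b) { S with R := L, R2 := lsep :: ((r.map .inr).reverse ++ S.R2), RR := if b then (r.map .inr).reverse ++ S.RR else S.RR } T G P) :
    At nx (.pickR b) { S with R := r.map .inr ++ lsep :: L } (T + r.length + 1) G P := by
  induction r generalizing S with
  | nil => exact .of_eff rfl fun v => by simpa using eff_go (by simpa using h)
  | cons a r ih =>
    refine .of_eff rfl fun v => ?_
    cases b <;> simp
    · refine eff_go (At.mono (ih (S := { S with R2 := .inr a :: S.R2 }) ?_) (by omega) le_rfl)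
      simpa using h
    · refine eff_go (At.mono (ih (S := { S with R2 := .inr a :: S.R2, RR := .inr a :: S.RR }) ?_) (by omega) le_rfl)
      simpa using h

theorem pickV_spec {b : Bool} {r : List Bool} {L : List Sym}
    (h : At nx .pick { S with V := L, V2 := lsep :: ((r.map .inr).reverse ++ S.V2), VR := if b then (r.map .inr).reverse ++ S.VR else S.VR } T G P) :
    At nx (.pickV b) { S with V := r.map .inr ++ lsep :: L } (T + r.length + 1) G P := by
  induction r generalizing S with
  | nil => exact .of_eff rfl fun v => by simpa using eff_go (by simpa using h)
  | cons a r ih =>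
    refine .of_eff rfl fun v => ?_
    cases b <;> simp
    · refine eff_go (At.mono (ih (S := { S with V2 := .inr a :: S.V2 }) ?_) (by omega) le_rfl)
      simpa using h
    · refine eff_go (At.mono (ih (S := { S with V2 := .inr a :: S.V2, VR := .inr a :: S.VR }) ?_) (by omega) le_rfl)
      simpa using h

theorem stkRow_append (r : List Bool) (L : List Sym) :
    stkRow r ++ L = r.reverse.map .inr ++ lsep :: L := by
  simp [stkRow]

theorem reverse_stkRow (r : List Bool) : (stkRow r).reverse = lsep :: r.map .inr := by
  simp [stkRow]

theorem pickRV_spec {b : Bool} {r s : List Bool} {L L' : List Sym}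
    (h : At nx .pick { S with R := L, V := L', R2 := (stkRow r).reverse ++ S.R2, V2 := (stkRow s).reverse ++ S.V2, RR := if b then r.map .inr ++ S.RR else S.RR, VR := if b then s.map .inr ++ S.VR else S.VR } T G P) :
    At nx (.pickR b) { S with R := stkRow r ++ L, V := stkRow s ++ L' }
      (T + (stkRow r).length + (stkRow s).length) G P := by
  have h1 := pickV_spec (nx := nx) (b := b) (r := s.reverse) (L := L') (T := T) (G := G) (P := P)
    (S := { S with R := L, R2 := (stkRow r).reverse ++ S.R2, RR := if b then r.map .inr ++ S.RR else S.RR })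
    (by simpa [reverse_stkRow] using h)
  have h2 := pickR_spec (nx := nx) (b := b) (r := r.reverse) (L := L) (G := G) (P := P)
    (S := { S with V := s.reverse.map .inr ++ lsep :: L' }) (by simpa [reverse_stkRow] using h1)
  rw [stkRow_append, stkRow_append]
  exact h2.mono (by simp [stkRow]; omega) le_rfl

/-- Since `ws` has no duplicates, at most one row is copied. The case distinction on `w ∈ ws` keeps
the statement inductive after the selected world has been passed. -/
theorem pick_spec {ι : Type} [DecidableEq ι] {ws : List ι} (hws : ws.Nodup) (w : ι) (f g : ι → List Bool)
    (h : At nx .restR { S with H := [], R := [], V := [], R2 := (ws.flatMap fun i => stkRow (f i)).reverse ++ S.R2, V2 := (ws.flatMap fun i => stkRow (g i)).reverse ++ S.V2, RR := if w ∈ ws then (f w).map .inr ++ S.RR else S.RR, VR := if w ∈ ws then (g w).map .inr ++ S.VR else S.VR } T G P) :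
    At nx .pick { S with H := ws.map (fun i => .inr (decide (i = w))), R := ws.flatMap fun i => stkRow (f i), V := ws.flatMap fun i => stkRow (g i) }
      (T + (ws.flatMap fun i => stkRow (f i)).length + (ws.flatMap fun i => stkRow (g i)).length + ws.length + 1) G P := by
  induction ws generalizing S with
  | nil => exact .of_eff rfl fun v => by simpa using eff_go (by simpa using h)
  | cons i ws ih =>
    rw [List.nodup_cons] at hws
    refine .of_eff rfl fun v => ?_
    simp only [List.flatMap_cons, List.map_cons, eff_rd, Store.get, Store.set, List.head?_cons,
      List.tail_cons, eff_ifn_some, eff_ifs_some, List.length_append, List.length_cons]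
    by_cases hi : i = w
    · subst hi
      have h' := pickRV_spec (b := true) (S := { S with H := ws.map fun j => .inr (decide (j = i)) })
        (ih (S := { S with R2 := (stkRow (f i)).reverse ++ S.R2, V2 := (stkRow (g i)).reverse ++ S.V2, RR := (f i).map .inr ++ S.RR, VR := (g i).map .inr ++ S.VR }) hws.2 (by simpa [hws.1] using h))
      simp [-List.length_flatMap]
      exact eff_go (h'.mono (by omega) le_rfl)
    · have h' := pickRV_spec (b := false) (S := { S with H := ws.map fun j => .inr (decide (j = w)) })
        (ih (S := { S with R2 := (stkRow (f i)).reverse ++ S.R2, V2 := (stkRow (g i)).reverse ++ S.V2 }) hws.2 (by simpa [Ne.symm hi] using h))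
      simp [hi, -List.length_flatMap]
      exact eff_go (h'.mono (by omega) le_rfl)

/-! ### Guessing a successor -/

/-- The two flags form a counter that saturates at two; `k` is the number of candidates met earlier.
-/
theorem scan_spec {l : List Bool} {k : ℕ}
    (h : At nx (if 2 ≤ k + l.count true then .guess else .clear) { S with RR := [], H := (l.map .inr).reverse ++ S.H } T G P) :
    At nx (.scan (decide (1 ≤ k)) (decide (2 ≤ k))) { S with RR := l.map .inr } (T + l.length + 1) G P := by
  induction l generalizing S k with
  | nil =>
    refine .of_eff rfl fun v => ?_
    by_cases hk : 2 ≤ k <;> simp [hk] at h ⊢ <;> exact eff_go h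
  | cons a l ih =>
    refine .of_eff rfl fun v => ?_
    cases a
    · simp
      exact eff_go (At.mono (ih (k := k) (S := { S with H := .inr false :: S.H }) (by simpa using h)) (by omega) le_rfl)
    · simp
      have := ih (k := k + 1) (S := { S with H := .inr true :: S.H }) (by simpa [show k + 1 + l.count true = k + (l.count true + 1) by omega] using h)
      simp at this
      exact eff_go (At.mono this (by omega) le_rfl)

/-- Keep every other `true`. -/
def halve : Bool → List Bool → List Bool
  | _, [] => []
  | g, true :: l => g :: halve (!g) l
  | g, false :: l => false :: halve g l

theorem thin_spec {l : List Bool} {g : Bool}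
    (h : At nx (.scan false false) { S with H := [], RR := ((halve g l).map .inr).reverse ++ S.RR } T G P) :
    At nx (.thin g) { S with H := l.map .inr } (T + l.length + 1) G P := by
  induction l generalizing S g with
  | nil => exact .of_eff rfl fun v => by simpa using eff_go (by simpa [halve] using h)
  | cons a l ih =>
    refine .of_eff rfl fun v => ?_
    cases a
    · simp
      exact eff_go (At.mono (ih (S := { S with RR := .inr false :: S.RR }) (by simpa [halve] using h)) (by omega) le_rfl)
    · simp
      exact eff_go (At.mono (ih (S := { S with RR := .inr g :: S.RR }) (by simpa [halve] using h)) (by omega) le_rfl)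

theorem length_halve (g : Bool) (l : List Bool) : (halve g l).length = l.length := by
  induction l generalizing g with
  | nil => rfl
  | cons a l ih => cases a <;> simp [halve, ih]

/-- The two thinnings keep ⌈c/2⌉ and ⌊c/2⌋ of c candidates, so neither is empty if c ≥ 2. -/
theorem count_halve (g : Bool) (l : List Bool) :
    (halve g l).count true = if g then (l.count true + 1) / 2 else l.count true / 2 := by
  induction l generalizing g with
  | nil => simp [halve]
  | cons a l ih =>
    cases a
    · simp [halve, ih]
    · cases g <;> simp [halve, ih]
      omega

/-- The thinnings alternate in opposite phase, so every candidate survives in one of them. -/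
theorem mem_zip_halve {ι : Type} (w : ι) (l : List Bool) (ws : List ι) :
    (w, true) ∈ ws.zip l ↔ (w, true) ∈ ws.zip (halve true l) ∨ (w, true) ∈ ws.zip (halve false l) := by
  induction l generalizing ws with
  | nil => simp [halve]
  | cons a l ih =>
    cases ws with
    | nil => simp
    | cons i ws => cases a <;> (simp [halve, ih ws]; try tauto)

theorem eq_map_of_count_eq_zero {ι : Type} [DecidableEq ι] {ws : List ι} {l : List Bool} {w : ι}
    (hl : l.length = ws.length) (hc : l.count true = 0) (hw : w ∉ ws) :
    l = ws.map fun i => decide (i = w) := by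
  induction ws generalizing l with
  | nil => simpa using hl
  | cons i ws ih =>
    rcases l with _ | ⟨_ | _, l⟩
    · simp at hl
    · simp at hw
      simpa [Ne.symm hw.1] using ih (by simpa using hl) (by simpa using hc) hw.2
    · simp at hc

theorem exists_eq_map_of_count_eq_one {ι : Type} [DecidableEq ι] {ws : List ι} {l : List Bool}
    (hws : ws.Nodup) (hl : l.length = ws.length) (hc : l.count true = 1) :
    ∃ w ∈ ws, l = ws.map fun i => decide (i = w) := by
  induction ws generalizing l with
  | nil => simp_all
  | cons i ws ih =>
    rw [List.nodup_cons] at hws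
    rcases l with _ | ⟨_ | _, l⟩
    · simp at hl
    · obtain ⟨w, hw, h⟩ := ih hws.2 (by simpa using hl) (by simpa using hc)
      refine ⟨w, List.mem_cons_of_mem _ hw, ?_⟩
      have : i ≠ w := by rintro rfl; exact hws.1 hw
      simp [this, h]
    · refine ⟨i, by simp, ?_⟩
      simp [← eq_map_of_count_eq_zero (w := i) (by simpa using hl) (by simpa using hc) hws.1]

theorem mem_zip_map {ι : Type} (ws : List ι) (f : ι → Bool) (w : ι) :
    (w, true) ∈ ws.zip (ws.map f) ↔ w ∈ ws ∧ f w = true := by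
  induction ws with
  | nil => simp
  | cons i ws ih =>
    simp [ih]
    constructor
    · rintro (⟨rfl, h⟩ | h)
      · exact ⟨.inl rfl, h⟩
      · exact ⟨.inr h.1, h.2⟩
    · rintro ⟨rfl | h, h'⟩
      · exact .inl ⟨rfl, h'⟩
      · exact .inr ⟨h, h'⟩

/-- Halving needs ⌈log₂ c⌉ guesses for c candidates. Every branch ends in a candidate, and every
candidate is reached. A halving costs 2 · `ws.length` + 3 steps (scan, guess, thin); bounding the
number of scans by c is crude but sufficient. -/
theorem choose_spec {ι : Type} [DecidableEq ι] {ws : List ι} (hws : ws.Nodup) {l : List Bool}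
    (hl : l.length = ws.length) (hc : 1 ≤ l.count true) {Q : ι → Prop}
    (h : ∀ w, (w, true) ∈ ws.zip l →
      At nx .clear { S with RR := [], H := ws.map fun i => .inr (decide (i = w)) } T G (Q w)) :
    At nx (.scan false false) { S with RR := (l.map .inr).reverse, H := [] }
      (T + (2 * ws.length + 3) * l.count true) (G + Nat.clog 2 (l.count true))
      (∃ w, (w, true) ∈ ws.zip l ∧ Q w) := by
  induction hk : l.count true using Nat.strong_induction_on generalizing l with
  | _ k ih =>
  subst hk
  have hscan := fun (T' G' : ℕ) (P' : Prop) => scan_spec (nx := nx) (l := l.reverse) (k := 0) (T := T') (G := G')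
    (P := P') (S := { S with H := [] })
  simp only [zero_add, List.count_reverse, List.map_reverse, List.reverse_reverse,
    List.append_nil, List.length_reverse, hl] at hscan
  rcases Nat.lt_or_ge (l.count true) 2 with h2 | h2
  · have h1 : l.count true = 1 := by omega
    obtain ⟨w, hw, he⟩ := exists_eq_map_of_count_eq_one hws hl h1
    have hz : ∀ w', (w', true) ∈ ws.zip l ↔ w' = w := by
      intro w'
      rw [he, mem_zip_map]
      simp
      rintro rfl
      exact hw
    have hQ : (∃ w, (w, true) ∈ ws.zip l ∧ Q w) = Q w := by simp [hz]
    rw [hQ]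
    refine At.mono (hscan T G _ ?_) (by rw [h1]; omega) (by omega)
    rw [if_neg (by omega)]
    have := h w ((hz w).2 rfl)
    rw [he]
    simpa [Function.comp_def] using this
  · have hQ : (∃ w, (w, true) ∈ ws.zip l ∧ Q w) = ((∃ w, (w, true) ∈ ws.zip (halve true l) ∧ Q w) ∨
        ∃ w, (w, true) ∈ ws.zip (halve false l) ∧ Q w) := by
      simp only [mem_zip_halve _ l, or_and_right, exists_or]
    have key : ∀ g, At nx (.thin g) { S with RR := [], H := l.map .inr }
        (T + (2 * ws.length + 3) * (l.count true - 1) + ws.length + 1)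
        (G + Nat.clog 2 ((l.count true + 1) / 2)) (∃ w, (w, true) ∈ ws.zip (halve g l) ∧ Q w) := by
      intro g
      have hcg := count_halve g l
      have hle : (halve g l).count true ≤ (l.count true + 1) / 2 := by
        rw [hcg]; split_ifs <;> omega
      have hge : 1 ≤ (halve g l).count true := by
        rw [hcg]; split_ifs <;> omega
      have := ih _ (by omega) (l := halve g l) (by rw [length_halve, hl]) hge
        (fun w hw => h w ((mem_zip_halve w l ws).2 (by cases g <;> tauto))) rfl
      rw [← hl]
      refine At.mono (thin_spec (S := { S with RR := [] }) (by simpa using this)) ?_ ?_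
      · rw [hl]
        gcongr
        omega
      · gcongr
    rw [hQ]
    refine At.mono (hscan _ _ _ ?_) ?_ le_rfl (T := T + (2 * ws.length + 3) * (l.count true - 1) + ws.length + 1 + 1 + ws.length + 1)
    -- For c ≥ 2, `Nat.clog 2 c` is one more than `Nat.clog 2` of ⌈c/2⌉: the larger half bounds both
    -- branches, and the extra one is the guess made here.
    · rw [if_pos h2, Nat.clog_of_one_lt (by norm_num) (by omega), ← add_assoc]
      exact At.guess _ (key true) (key false)
    · obtain ⟨c, hc'⟩ : ∃ c, l.count true = c + 1 := ⟨l.count true - 1, by omega⟩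
      rw [hc', Nat.add_sub_cancel, Nat.mul_succ]
      omega

/-! ### Semantics of progression -/

section semantics

variable {n m : ℕ} (A : Kripke (Fin n) (Fin m))

/-- Satisfaction on a path. -/
def Fm.Sat : (ℕ → Fin n) → Fm m nx → Prop
  | _, .tt c => c = true
  | π, .var p => p ∈ A.V (π 0)
  | π, .neg φ => ¬ φ.Sat π
  | π, .and φ ψ => φ.Sat π ∧ ψ.Sat π
  | π, .next _ φ => φ.Sat fun i => π (i + 1)

/-- Some path from `w` does not satisfy `φ`. -/
def Refuted (w : Fin n) (φ : Fm m nx) : Prop :=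
  ∃ π, A.IsPath π ∧ π 0 = w ∧ ¬ φ.Sat A π

open Classical in
/-- The propositions true in `w`. -/
noncomputable def vals (w : Fin n) (p : Fin m) : Bool := decide (p ∈ A.V w)

open Classical in
/-- The row of `w` in the adjacency matrix. -/
noncomputable def adj (w w' : Fin n) : Bool := decide (A.R w w')

/-- Propositions outside every `X` concern only `π 0` and become constants; deleting an outermost
`X` is made up for by the shift of the path. -/
theorem Fm.sat_fwd (π : ℕ → Fin n) (φ : Fm m nx) :
    φ.Sat A π ↔ (φ.fwd (vals A (π 0)) false).Sat A fun i => π (i + 1) := by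
  induction φ with
  | tt c => rfl
  | var p => simp [Fm.fwd, Fm.Sat, vals]
  | neg φ ih => simp [Fm.fwd, Fm.Sat, ih]
  | and φ ψ ih₁ ih₂ => simp [Fm.fwd, Fm.Sat, ih₁, ih₂]
  | next h φ _ => simp [Fm.fwd, Fm.Sat, Fm.fwd_true]

theorem Fm.sat_iff_val (π : ℕ → Fin n) (φ : Fm m nx) (hφ : φ.td = 0) :
    φ.Sat A π ↔ φ.val (vals A (π 0)) = true := by
  induction φ with
  | tt c => rfl
  | var p => simp [Fm.Sat, Fm.val, vals]
  | neg φ ih => simp [Fm.Sat, Fm.val, ih hφ]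
  | and φ ψ ih₁ ih₂ =>
    simp [Fm.td] at hφ
    simp [Fm.Sat, Fm.val, ih₁ hφ.1, ih₂ hφ.2]
  | next h φ _ => simp [Fm.td] at hφ

/-- Split off the first world of a path, or prepend `w` to one. -/
theorem refuted_iff_step (w : Fin n) (φ : Fm m nx) :
    Refuted A w φ ↔ ∃ w', A.R w w' ∧ Refuted A w' (φ.fwd (vals A w) false) := by
  constructor
  · rintro ⟨π, hπ, rfl, h⟩
    exact ⟨π 1, hπ 0, fun i => π (i + 1), fun i => hπ (i + 1), rfl, by rwa [← Fm.sat_fwd]⟩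
  · rintro ⟨w', hw, π, hπ, rfl, h⟩
    refine ⟨fun i => Nat.casesOn i w π, ?_, rfl, ?_⟩
    · rintro (_ | i)
      exacts [hw, hπ i]
    · rw [Fm.sat_fwd]
      exact h

theorem refuted_iff_val (w : Fin n) (φ : Fm m nx) (hφ : φ.td = 0) :
    Refuted A w φ ↔ φ.val (vals A w) = false := by
  constructor
  · rintro ⟨π, -, rfl, h⟩
    simpa [Fm.sat_iff_val A π φ hφ] using h
  · intro h
    -- The value settles the matter, but some path from `w` has to exist; totality supplies one by
    -- iterating a successor function.
    choose s hs using A.total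
    refine ⟨fun i => s^[i] w, fun i => ?_, rfl, ?_⟩
    · simp only [Function.iterate_succ_apply']
      exact hs _
    · rw [Fm.sat_iff_val A _ φ hφ]
      simp [h]

end semantics

/-! ### The main loop -/

section loop

variable {n m : ℕ} (A : Kripke (Fin n) (Fin m))

/-- The worlds in the order in which the stacks hold them. -/
def worlds (n : ℕ) : List (Fin n) := (List.finRange n).reverse

theorem nodup_worlds : (worlds n).Nodup := List.nodup_reverse.2 (List.nodup_finRange n)

theorem mem_worlds (w : Fin n) : w ∈ worlds n := by simp [worlds]

theorem length_worlds : (worlds n).length = n := by simp [worlds]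

/-- The adjacency matrix on a stack. -/
noncomputable def stkR : List Sym := (worlds n).flatMap fun i => stkRow ((List.finRange n).map (adj A i))

/-- The valuation matrix on a stack. -/
noncomputable def stkV : List Sym := (worlds n).flatMap fun i => stkRow (List.ofFn (vals A i))

theorem length_stkR : (stkR A).length = n * (n + 1) := by
  simp [stkR, stkRow, length_worlds, List.length_flatMap]

theorem length_stkV : (stkV A).length = n * (m + 1) := by
  simp [stkV, stkRow, length_worlds, List.length_flatMap]

/-- The content of the stacks when the current world is to be looked up. -/
noncomputable def loopStore (S : Store) (w : Fin n) (L vr : List Sym) : Store :=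
  { S with F := L, R := stkR A, R2 := [], V := stkV A, V2 := [], RR := [], VR := vr, VT := [],
           H := (worlds n).map fun i => .inr (decide (i = w)), P := [], B := [], E := [] }

/-- The content of the stacks after a pass. -/
noncomputable def passStore (S : Store) (w : Fin n) (B : List Sym) : Store :=
  { S with F := [], R := stkR A, R2 := [], V := stkV A, V2 := [],
           RR := (((worlds n).map (adj A w)).map .inr).reverse,
           VR := (List.ofFn (vals A w)).map .inr, VT := [], H := [], P := [], B := B, E := [] }

/-- The deterministic part of a round: look up the rows of the current world, restore the matrices,
make one pass. It costs no guess, and a syntax error ends the computation here. -/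
theorem round_spec (w : Fin n) {L vr : List Sym}
    (h : ∀ φ : Fm m nx, L = φ.toks →
      At nx (.pass (φ.td != 0)) (passStore A S w (φ.fwd (vals A w) false).toks.reverse) T G P)
    (hP : (∀ φ : Fm m nx, L ≠ φ.toks) → P) :
    At nx .clear (loopStore A S w L vr)
      (T + 2 * L.length + vr.length + 2 * (n * (n + 1)) + 2 * (n * (m + 1)) + n + 5) G P := by
  have hlen : ∀ φs : List (Fm m nx), φs.length = [false].length → ∃ φ, φs = [φ] := by
    intro φs hl
    exact List.length_eq_one_iff.1 hl
  have h1 := pass_spec (nx := nx) (T := T) (G := G) (P := P) (v := vals A w) rfl (L := L)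
    (ps := [false]) (seen := false)
    (S := { S with R := stkR A, R2 := [], V := stkV A, V2 := [], RR := (((worlds n).map (adj A w)).map .inr).reverse, H := [], B := [], E := [] })
    (by
      intro φs hl he
      obtain ⟨φ, rfl⟩ := hlen φs hl
      simpa [passOut, passSeen, passStore] using h φ (by simpa using he))
    (by
      intro hn
      exact hP fun φ he => hn [φ] rfl (by simpa using he))
  have h2 := restV_spec (nx := nx) (l := (stkV A).reverse)
    (S := { S with F := L, R := stkR A, R2 := [], V := [], RR := (((worlds n).map (adj A w)).map .inr).reverse, VR := (List.ofFn (vals A w)).map .inr, VT := [], H := [], P := [], B := [], E := [] })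
    (by rw [List.reverse_reverse, List.append_nil]; exact h1)
  have h3 := restR_spec (nx := nx) (l := (stkR A).reverse)
    (S := { S with F := L, R := [], V := [], V2 := (stkV A).reverse, RR := (((worlds n).map (adj A w)).map .inr).reverse, VR := (List.ofFn (vals A w)).map .inr, VT := [], H := [], P := [], B := [], E := [] })
    (by rw [List.reverse_reverse, List.append_nil]; exact h2)
  -- Stacked rows have their last entry on top, so the copy in `RR` has its first entry on top.
  -- Scanning `RR` onto `H` reverses it again, which gives the order `worlds n` of the stacked rows,
  -- as the next lookup requires.
  have hrow : (((worlds n).map (adj A w)).map Sum.inr).reverse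
      = ((List.finRange n).map (adj A w)).map (Sum.inr : Bool → Sym) := by simp [worlds]
  have h4 := pick_spec (nx := nx) nodup_worlds w (fun i => (List.finRange n).map (adj A i))
    (fun i => List.ofFn (vals A i))
    (S := { S with F := L, R2 := [], V2 := [], RR := [], VR := [], VT := [], P := [], B := [], E := [] })
    (by
      simp only [if_pos (mem_worlds w), List.append_nil, ← hrow]
      exact h3)
  refine (clear_spec (S := loopStore A S w L []) h4).mono ?_ le_rfl
  change T + 2 * L.length + 1 + (stkV A).reverse.length + 1 + (stkR A).reverse.length + 1 +
    (stkR A).length + (stkV A).length + (worlds n).length + 1 + vr.length + 1 ≤ _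
  simp only [List.length_reverse, length_stkR, length_stkV, length_worlds]
  omega

/-- A bound for the time of one iteration of the main loop, if the formula has length at most `l`. -/
def roundTime (n m l : ℕ) : ℕ :=
  2 * l + m + 2 * (n * (n + 1)) + 2 * (n * (m + 1)) + n + 5 + (l + 3) + (2 * n + 3) * n

/-- Induction on the depth. At depth zero the pass meets no `X`, and the formula is evaluated in
place without a guess. Otherwise a successor is guessed and the progressed formula, of depth one
less, is treated there. -/
theorem loop_spec (l : ℕ) (w : Fin n) (φ : Fm m nx) (hl : φ.toks.length ≤ l) {vr : List Sym}
    (hvr : vr.length ≤ m) :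
    At nx .clear (loopStore A S w φ.toks vr) (roundTime n m l * (φ.td + 1))
      (φ.td * Nat.clog 2 n) (Refuted A w φ) := by
  induction hd : φ.td generalizing w φ vr with
  | zero =>
    have h2 : At nx (.pass false) (passStore A S w (φ.fwd (vals A w) false).toks.reverse)
        (l + 2) 0 (Refuted A w φ) := by
      rw [refuted_iff_val A w φ hd]
      refine At.mono (T := 0 + 1 + (φ.fwd (vals A w) false).toks.length + 1) (.of_eff rfl fun v => ?_)
        (by have := Fm.length_toks_fwd (vals A w) false φ; omega) le_rfl
      simp only [passStore, eff_rd, eff_ifn_none, Store.get, Store.set, List.head?_nil,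
        List.tail_nil, cond_false]
      have := eval_spec (nx := nx) (S := { passStore A S w [] with B := [] }) (vals A w) φ hd
        (T := 0 + 1) (G := 0) eval_end
      exact eff_go (by simpa [passStore] using this)
    refine At.mono (round_spec A w (T := l + 2) (G := 0) (P := Refuted A w φ) ?_ ?_) ?_ (by simp)
    · intro φ' he
      obtain ⟨rfl, -⟩ := Fm.toks_inj φ φ' [] [] (by simpa using he)
      simpa [hd] using h2
    · exact fun hn => absurd rfl (hn φ)
    · simp only [roundTime]
      omega
  | succ d ih =>
    set ψ := φ.fwd (vals A w) false with hψ
    have hlψ : ψ.toks.length ≤ φ.toks.length := Fm.length_toks_fwd _ _ _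
    have hdψ : ψ.td = d := by rw [hψ, Fm.td_fwd, hd]; rfl
    have hz : ∀ w', (w', true) ∈ (worlds n).zip ((worlds n).map (adj A w)) ↔ A.R w w' := by
      intro w'
      simp [mem_zip_map, mem_worlds, adj]
    have hcount : 1 ≤ ((worlds n).map (adj A w)).count true := by
      obtain ⟨w', hw'⟩ := A.total w
      exact List.count_pos_iff.2 (List.mem_map.2 ⟨w', mem_worlds w', by simpa [adj] using hw'⟩)
    have hcount' : ((worlds n).map (adj A w)).count true ≤ n :=
      List.count_le_length.trans (by simp [length_worlds])
    have hc := choose_spec (nx := nx) nodup_worlds (l := (worlds n).map (adj A w))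
      (S := { passStore A S w [] with F := ψ.toks }) (by simp) hcount
      (Q := fun w' => Refuted A w' ψ) (T := roundTime n m l * (d + 1)) (G := d * Nat.clog 2 n)
      (fun w' _ => ih w' ψ (hlψ.trans hl) (vr := (List.ofFn (vals A w)).map .inr) (by simp) hdψ)
    simp only [hz] at hc
    rw [show (∃ w', A.R w w' ∧ Refuted A w' ψ) = Refuted A w φ from
      propext (refuted_iff_step A w φ).symm] at hc
    have hcopy := copy_spec (nx := nx) (S := passStore A S w []) (l := ψ.toks.reverse)
      (by simpa [passStore] using hc)
    have h2 : At nx (.pass true) (passStore A S w ψ.toks.reverse)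
        (roundTime n m l * (d + 1) + (2 * n + 3) * n + l + 2) ((d + 1) * Nat.clog 2 n)
        (Refuted A w φ) := by
      refine At.mono (.of_eff rfl fun v => ?_) (T := roundTime n m l * (d + 1) + (2 * n + 3) * n + l + 1 + 1)
        (by omega) le_rfl
      simp only [passStore, eff_rd, eff_ifn_none, Store.get, Store.set, List.head?_nil,
        List.tail_nil, cond_true]
      refine eff_go (At.mono hcopy ?_ ?_)
      · simp only [length_worlds, List.length_reverse]
        gcongr
        exact hlψ.trans hl
      · rw [Nat.succ_mul]
        gcongr
    refine At.mono (round_spec A w (P := Refuted A w φ)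
      (T := roundTime n m l * (d + 1) + (2 * n + 3) * n + l + 2) ?_ ?_) ?_ le_rfl
    · intro φ' he
      obtain ⟨rfl, -⟩ := Fm.toks_inj φ φ' [] [] (by simpa using he)
      simpa [hd] using h2
    · exact fun hn => absurd rfl (hn φ)
    · rw [Nat.mul_succ _ (d + 1)]
      generalize roundTime n m l * (d + 1) = X
      simp only [roundTime]
      omega

end loop

/-! ### The header as a whole -/

section header

variable {n m : ℕ}

/-- The encoding of an instance whose formula is encoded by `y`. -/
noncomputable def header (A : Kripke (Fin n) (Fin m)) (w : Fin n) (y : List Letter) : List Letter :=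
  List.replicate n Letter.one ++ Letter.sep ::
  (List.replicate m Letter.one ++ Letter.sep ::
  (((List.finRange n).flatMap fun i => (List.finRange n).map fun j => MCInstance.bit (A.R i j)) ++
  (((List.finRange n).flatMap fun i => (List.finRange m).map fun p => MCInstance.bit (p ∈ A.V i)) ++
  (List.replicate w Letter.one ++ Letter.sep :: y))))

/-- The rows of the adjacency matrix. -/
noncomputable def rowsR (A : Kripke (Fin n) (Fin m)) : List (List Bool) :=
  (List.finRange n).map fun i => (List.finRange n).map (adj A i)

/-- The rows of the valuation matrix. -/
noncomputable def rowsV (A : Kripke (Fin n) (Fin m)) : List (List Bool) :=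
  (List.finRange n).map fun i => (List.finRange m).map (vals A i)

theorem map_header (A : Kripke (Fin n) (Fin m)) (w : Fin n) (y : List Letter) :
    (header A w y).map Sum.inl = List.replicate n lone ++ lsep :: (List.replicate m lone ++ lsep ::
      ((rowsR A).flatten.map bl ++ ((rowsV A).flatten.map bl ++
        (List.replicate w lone ++ lsep :: y.map Sum.inl)))) := by
  have h1 : ∀ i j, bl (adj A i j) = Sum.inl (MCInstance.bit (A.R i j)) := by
    intro i j
    by_cases h : A.R i j <;> simp [bl, adj, MCInstance.bit, h]
  have h2 : ∀ i p, bl (vals A i p) = Sum.inl (MCInstance.bit (p ∈ A.V i)) := by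
    intro i p
    by_cases h : p ∈ A.V i <;> simp [bl, vals, MCInstance.bit, h]
  simp [header, rowsR, rowsV, List.flatMap, List.map_flatten, Function.comp_def, h1, h2]

theorem exists_eq_map_finRange {α : Type} {k : ℕ} {l : List α} (h : l.length = k) :
    ∃ f : Fin k → α, l = (List.finRange k).map f := by
  subst h
  exact ⟨l.get, by simp [← List.ofFn_eq_map]⟩

theorem exists_eq_map_map_finRange {α : Type} {k k' : ℕ} {l : List (List α)} (h : l.length = k)
    (h' : ∀ r ∈ l, r.length = k') :
    ∃ f : Fin k → Fin k' → α, l = (List.finRange k).map fun i => (List.finRange k').map (f i) := by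
  obtain ⟨g, rfl⟩ := exists_eq_map_finRange h
  have : ∀ i, ∃ f : Fin k' → α, g i = (List.finRange k').map f := fun i =>
    exists_eq_map_finRange (h' _ (List.mem_map.2 ⟨i, List.mem_finRange i, rfl⟩))
  choose f hf using this
  exact ⟨f, by simp [← hf]⟩

/-- The condition `true ∈ r` on the adjacency rows is totality. -/
theorem exists_kripke {rows vrows : List (List Bool)} (h₁ : rows.length = n)
    (h₂ : ∀ r ∈ rows, r.length = n ∧ true ∈ r) (h₃ : vrows.length = n)
    (h₄ : ∀ r ∈ vrows, r.length = m) :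
    ∃ A : Kripke (Fin n) (Fin m), rows = rowsR A ∧ vrows = rowsV A := by
  obtain ⟨f, rfl⟩ := exists_eq_map_map_finRange h₁ fun r hr => (h₂ r hr).1
  obtain ⟨g, rfl⟩ := exists_eq_map_map_finRange h₃ h₄
  refine ⟨⟨fun i j => f i j = true, fun i => ?_, fun i => {p | g i p = true}⟩, ?_, ?_⟩
  · simpa using (h₂ _ (List.mem_map.2 ⟨i, List.mem_finRange i, rfl⟩)).2
  · simp [rowsR, adj]
  · simp [rowsV, vals]

theorem length_flatten_rowsR (A : Kripke (Fin n) (Fin m)) : (rowsR A).flatten.length = n * n := by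
  simp [rowsR, List.length_flatten, Function.comp_def]

theorem length_flatten_rowsV (A : Kripke (Fin n) (Fin m)) : (rowsV A).flatten.length = n * m := by
  simp [rowsV, List.length_flatten, Function.comp_def]

theorem map_worlds (w : Fin n) : ((worlds n).map fun i => (Sum.inr (decide (i = w)) : Sym)) =
    List.replicate (n - 1 - w) (.inr false) ++ .inr true :: (List.replicate w (.inr false)) := by
  have : ((List.finRange n).map fun i => (Sum.inr (decide (i = w)) : Sym)) =
      List.replicate w (.inr false) ++ .inr true :: (List.replicate (n - 1 - w) (.inr false)) := by
    apply List.ext_getElem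
    · simp
      omega
    · intro i h1 h2
      simp [List.getElem_append, List.getElem_cons, Fin.ext_iff]
      split_ifs <;> simp <;> omega
  rw [worlds, List.map_reverse, this]
  simp

theorem header_inj {n' m' : ℕ} {A : Kripke (Fin n) (Fin m)} {A' : Kripke (Fin n') (Fin m')}
    {w : Fin n} {w' : Fin n'} {y y' : List Letter} (h : header A w y = header A' w' y') :
    n = n' ∧ m = m' ∧ y = y' := by
  obtain ⟨rfl, h⟩ := MCInstance.replicate_sep_inj h
  obtain ⟨rfl, h⟩ := MCInstance.replicate_sep_inj h
  obtain ⟨-, h⟩ := List.append_inj h (by rw [MCInstance.flatMap_length, MCInstance.flatMap_length])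
  obtain ⟨-, h⟩ := List.append_inj h
    (by rw [MCInstance.flatMap_length fun i p => p ∈ A.V i, MCInstance.flatMap_length fun i p => p ∈ A'.V i])
  exact ⟨rfl, rfl, (MCInstance.replicate_sep_inj h).2⟩

theorem header_spec {x : List Letter}
    (h : ∀ (n m : ℕ) (A : Kripke (Fin n) (Fin m)) (w : Fin n) (y : List Letter), x = header A w y →
      At nx .clear (loopStore A { M := List.replicate m lone } w (y.map .inl) []) T G P)
    (hP : (∀ (n m : ℕ) (A : Kripke (Fin n) (Fin m)) (w : Fin n) (y : List Letter),
      x ≠ header A w y) → P) :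
    At nx .readN { F := x.map .inl } (T + 4 * x.length ^ 2 + 9 * x.length + 5) G P := by
  have hP' : (∀ (n m : ℕ) (A : Kripke (Fin n) (Fin m)) (w : Fin n) (y : List Letter),
      x.map Sum.inl ≠ List.replicate n lone ++ lsep :: (List.replicate m lone ++ lsep ::
      ((rowsR A).flatten.map bl ++ ((rowsV A).flatten.map bl ++
        (List.replicate w lone ++ lsep :: y.map Sum.inl))))) → P := by
    intro hn
    refine hP fun n m A w y hx => hn n m A w y ?_
    rw [hx, map_header]
  -- With N = |x|, the two unary numbers cost at most N + 1 each, the two matrices 2N² + 3N + 1 each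
  -- and the world N + 1. At every stage a word of the right form would contradict `hn`, by unique
  -- decomposition of what was read so far.
  refine At.mono (readN_spec (S := {}) (T := T + 4 * x.length ^ 2 + 8 * x.length + 4) ?_ fun hn => ?_)
    (by simp; omega) le_rfl
  rotate_left
  · exact hP' fun n m A w y hx => hn _ _ hx
  intro n L₁ hL₁
  have hn : n + 1 + L₁.length = x.length := by
    have := congrArg List.length hL₁
    simp at this
    omega
  simp only [List.append_nil]
  refine At.mono (T := T + 4 * x.length ^ 2 + 7 * x.length + 3 + L₁.length + 1) (G := G) ?_ (by omega) le_rfl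
  refine readM_spec (L := L₁) (S := { NA := List.replicate n lone, NB := List.replicate n lone, NC := List.replicate n lone }) ?_ fun hn => ?_
  rotate_left
  · refine hP' fun n' m A w y hx => hn m _ (replicate_lsep_inj (hL₁.symm.trans hx)).2
  intro m L₂ hL₂
  have hm : m + 1 + L₂.length = L₁.length := by
    have := congrArg List.length hL₂
    simp at this
    omega
  have hnn : n * (2 * n + 3) ≤ 2 * x.length ^ 2 + 3 * x.length := by
    have : n * (2 * n + 3) ≤ x.length * (2 * x.length + 3) := by gcongr <;> omega
    linarith
  have hnm : n * (2 * m + 3) ≤ 2 * x.length ^ 2 + 3 * x.length := by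
    have : n * (2 * m + 3) ≤ x.length * (2 * x.length + 3) := by gcongr <;> omega
    linarith
  simp only [List.append_nil]
  refine At.mono (T := T + 2 * x.length ^ 2 + 4 * x.length + 2 + n * (2 * n + 3) + 1) (G := G) ?_ (by omega) le_rfl
  refine rowR_spec (L := L₂) (k := n) (n := n) (S := { NC := List.replicate n lone, M := List.replicate m lone }) ?_ fun hn => ?_
  rotate_left
  · refine hP' fun n' m' A w y hx => ?_
    obtain ⟨rfl, hx⟩ := replicate_lsep_inj (hL₁.symm.trans hx)
    obtain ⟨rfl, hx⟩ := replicate_lsep_inj (hL₂.symm.trans hx)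
    refine hn (rowsR A) _ (by simp [rowsR]) ?_ hx
    intro r hr
    obtain ⟨i, -, rfl⟩ := List.mem_map.1 hr
    obtain ⟨j, hj⟩ := A.total i
    exact ⟨by simp, List.mem_map.2 ⟨j, List.mem_finRange j, by simpa [adj] using hj⟩⟩
  intro rows L₃ hrows hrows' hL₃
  simp only [List.append_nil]
  refine At.mono (T := T + x.length + 1 + n * (2 * m + 3) + 1) (G := G) ?_ (by omega) le_rfl
  refine rowV_spec (L := L₃) (k := n) (n := m) (S := { NB := List.replicate n lone, R := rows.reverse.flatMap stkRow }) ?_ fun hn => ?_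
  rotate_left
  · refine hP' fun n' m' A w y hx => ?_
    obtain ⟨rfl, hx⟩ := replicate_lsep_inj (hL₁.symm.trans hx)
    obtain ⟨rfl, hx⟩ := replicate_lsep_inj (hL₂.symm.trans hx)
    obtain ⟨-, hx⟩ := List.append_inj (hL₃.symm.trans hx) (by
      rw [List.length_map, List.length_map, length_flatten_rowsR, List.length_flatten,
        List.map_congr_left fun r hr => (hrows' r hr).1]
      simp [hrows])
    refine hn (rowsV A) _ (by simp [rowsV]) ?_ hx
    intro r hr
    obtain ⟨i, -, rfl⟩ := List.mem_map.1 hr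
    simp
  intro vrows L₄ hvrows hvrows' hL₄
  obtain ⟨A, rfl, rfl⟩ := exists_kripke hrows hrows' hvrows hvrows'
  simp only [List.append_nil]
  refine At.mono (T := T + n + 1) (G := G) ?_ (by omega) le_rfl
  refine readW_spec (L := L₄) (k := n) (S := { R := (rowsR A).reverse.flatMap stkRow, V := (rowsV A).reverse.flatMap stkRow, M := List.replicate m lone }) ?_ fun hn => ?_
  rotate_left
  · refine hP' fun n' m' A' w y hx => ?_
    obtain ⟨rfl, hx⟩ := replicate_lsep_inj (hL₁.symm.trans hx)
    obtain ⟨rfl, hx⟩ := replicate_lsep_inj (hL₂.symm.trans hx)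
    obtain ⟨-, hx⟩ := List.append_inj (hL₃.symm.trans hx) (by
      rw [List.length_map, List.length_map, length_flatten_rowsR, length_flatten_rowsR])
    obtain ⟨-, hx⟩ := List.append_inj (hL₄.symm.trans hx) (by
      rw [List.length_map, List.length_map, length_flatten_rowsV, length_flatten_rowsV])
    exact hn w _ w.2 hx
  intro w L₅ hw hL₅
  -- `L₅` is a suffix of the input, so it contains no truth values.
  obtain ⟨y, rfl⟩ : ∃ y : List Letter, L₅ = y.map Sum.inl := by
    rw [hL₂, hL₃, hL₄, hL₅] at hL₁
    have : L₅ ∈ Set.range (List.map (Sum.inl : Letter → Sym)) := by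
      rw [Set.range_list_map]
      intro a ha
      have : a ∈ x.map (Sum.inl : Letter → Sym) := by
        rw [hL₁]
        simp [ha]
      obtain ⟨b, -, hb⟩ := List.mem_map.1 this
      exact ⟨b, hb⟩
    obtain ⟨y, hy⟩ := this
    exact ⟨y, hy.symm⟩
  have hx : x = header A ⟨w, hw⟩ y := by
    have hinj : Function.Injective (List.map (Sum.inl : Letter → Sym)) :=
      List.map_injective_iff.2 Sum.inl_injective
    apply hinj
    rw [map_header, hL₁, hL₂, hL₃, hL₄, hL₅]
  have := h n m A ⟨w, hw⟩ y hx
  have hR : (rowsR A).reverse.flatMap stkRow = stkR A := by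
    simp [rowsR, stkR, worlds, List.flatMap, Function.comp_def]
  have hV : (rowsV A).reverse.flatMap stkRow = stkV A := by
    simp [rowsV, stkV, worlds, List.flatMap, Function.comp_def, List.ofFn_eq_map]
  rw [hR, hV]
  simpa [loopStore, map_worlds] using this

end header

/-! ### The machine decides the complement of model checking -/

section correct

variable {n m : ℕ}

/-- Constants cannot occur in the formula, as its symbols all come from letters. -/
theorem Fm.exists_ltl {Op : Set TempOp} (hX : nx = true → TempOp.X ∈ Op)
    (A : Kripke (Fin n) (Fin m)) (φ : Fm m nx) {y : List Letter}
    (h : y.map Sum.inl = φ.toks) :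
    ∃ ψ : LTL (Fin m), ψ.encode = y ∧ ψ.ops ⊆ Op ∧ ψ.td = φ.td ∧ ∀ π, A.Sat π ψ ↔ φ.Sat A π := by
  have hinj : Function.Injective (List.map (Sum.inl : Letter → Sym)) :=
    List.map_injective_iff.2 Sum.inl_injective
  induction φ generalizing y with
  | tt c => cases y <;> simp [Fm.toks] at h
  | var p =>
    refine ⟨.var p, hinj ?_, by simp [LTL.ops], rfl, fun π => Iff.rfl⟩
    rw [h]
    simp [LTL.encode, Fm.toks]
  | neg φ ih =>
    obtain ⟨a, y, rfl, ha, hy⟩ := List.map_eq_cons_iff.1 h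
    obtain ⟨ψ, rfl, ho, ht, hs⟩ := ih hy
    cases ha
    exact ⟨.neg ψ, rfl, ho, ht, fun π => not_congr (hs π)⟩
  | and φ₁ φ₂ ih₁ ih₂ =>
    obtain ⟨a, y, rfl, ha, hy⟩ := List.map_eq_cons_iff.1 h
    obtain ⟨y₁, y₂, rfl, hy₁, hy₂⟩ := List.map_eq_append_iff.1 hy
    obtain ⟨ψ₁, rfl, ho₁, ht₁, hs₁⟩ := ih₁ hy₁
    obtain ⟨ψ₂, rfl, ho₂, ht₂, hs₂⟩ := ih₂ hy₂
    cases ha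
    refine ⟨.and ψ₁ ψ₂, rfl, Set.union_subset ho₁ ho₂, ?_, fun π => and_congr (hs₁ π) (hs₂ π)⟩
    simp [LTL.td, Fm.td, ht₁, ht₂]
  | next hn φ ih =>
    obtain ⟨a, y, rfl, ha, hy⟩ := List.map_eq_cons_iff.1 h
    obtain ⟨ψ, rfl, ho, ht, hs⟩ := ih hy
    cases ha
    refine ⟨.next ψ, rfl, Set.union_subset (by simpa using hX hn) ho, ?_, fun π => hs _⟩
    simp [LTL.td, Fm.td, ht]

theorem exists_toks {Op : Set TempOp} (hOp : Op ⊆ {TempOp.X}) (hX : TempOp.X ∈ Op → nx = true)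
    (ψ : LTL (Fin m)) (hψ : ψ.ops ⊆ Op) : ∃ φ : Fm m nx, ψ.encode.map Sum.inl = φ.toks := by
  have hno : ∀ o ∈ Op, o = TempOp.X := fun o ho => hOp ho
  induction ψ with
  | var p => exact ⟨.var p, by simp [LTL.encode, Fm.toks]⟩
  | neg ψ ih =>
    obtain ⟨φ, hφ⟩ := ih hψ
    exact ⟨.neg φ, by simp [LTL.encode, Fm.toks, hφ]⟩
  | and ψ₁ ψ₂ ih₁ ih₂ =>
    obtain ⟨h₁, h₂⟩ := Set.union_subset_iff.1 hψ
    obtain ⟨φ₁, hφ₁⟩ := ih₁ h₁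
    obtain ⟨φ₂, hφ₂⟩ := ih₂ h₂
    exact ⟨.and φ₁ φ₂, by simp [LTL.encode, Fm.toks, hφ₁, hφ₂]⟩
  | next ψ ih =>
    obtain ⟨h₁, h₂⟩ := Set.union_subset_iff.1 hψ
    obtain ⟨φ, hφ⟩ := ih h₂
    exact ⟨.next (hX (h₁ rfl)) φ, by simp [LTL.encode, Fm.toks, hφ]⟩
  | fin ψ _ => cases hno _ (hψ (.inl rfl))
  | glob ψ _ => cases hno _ (hψ (.inl rfl))
  | untl ψ₁ ψ₂ _ _ => cases hno _ (hψ (.inl rfl))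

theorem length_header (A : Kripke (Fin n) (Fin m)) (w : Fin n) (y : List Letter) :
    (header A w y).length = n + 1 + (m + 1 + (n * n + (n * m + (w + 1 + y.length)))) := by
  have := congrArg List.length (map_header A w y)
  simp only [List.length_map, List.length_append, List.length_replicate, List.length_cons,
    length_flatten_rowsR, length_flatten_rowsV] at this
  omega

theorem roundTime_mono {n m l N : ℕ} (hn : n ≤ N) (hm : m ≤ N) (hl : l ≤ N) :
    roundTime n m l ≤ roundTime N N N := by
  unfold roundTime
  gcongr

theorem main_spec {Op : Set TempOp} (hOp : Op ⊆ {TempOp.X}) (hX : TempOp.X ∈ Op ↔ nx = true)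
    (x : List Letter) :
    At nx .readN { F := x.map .inl }
      (roundTime x.length x.length x.length * (tdParam x + 1) + 4 * x.length ^ 2 + 9 * x.length + 5)
      (tdParam x * Nat.log 2 x.length) (x ∉ (LTLMC Op).lang) := by
  refine header_spec ?_ ?_
  · rintro n m A w y rfl
    have hlen := length_header A w y
    by_cases hφ : ∃ φ : Fm m nx, y.map Sum.inl = φ.toks
    · obtain ⟨φ, hφ⟩ := hφ
      obtain ⟨ψ, rfl, ho, ht, hs⟩ := φ.exists_ltl hX.2 A hφ
      have hI : header A w ψ.encode = (⟨n, m, A, w, ψ⟩ : MCInstance).encode := rfl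
      have hQ : (header A w ψ.encode ∉ (LTLMC Op).lang) = Refuted A w φ := by
        have : header A w ψ.encode ∈ (LTLMC Op).lang ↔ (⟨n, m, A, w, ψ⟩ : MCInstance).Holds := by
          rw [hI]
          constructor
          · rintro ⟨J, hJ, -, h⟩
            rwa [← MCInstance.encode_injective hJ]
          · exact fun h => ⟨_, rfl, ho, h⟩
        rw [this]
        simp [MCInstance.Holds, Refuted, hs]
      have hp : tdParam (header A w ψ.encode) = φ.td := by
        rw [hI, tdParam_encode]
        exact ht
      rw [hQ, hp, hφ]
      refine (loop_spec A (header A w ψ.encode).length w φ ?_ (vr := []) (by simp)).mono ?_ ?_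
      · rw [← hφ, List.length_map]
        omega
      · gcongr
        exact roundTime_mono (by omega) (by omega) le_rfl
      · gcongr
        -- Rounding up costs a factor 2 inside the logarithm, which the word can pay: its length is
        -- at least n + n², hence at least 2n.
        calc Nat.clog 2 n ≤ Nat.log 2 n + 1 := 
              Nat.clog_le_of_le_pow (Nat.lt_pow_succ_log_self (by norm_num) n).le
          _ = Nat.log 2 (n * 2) := (Nat.log_mul_base (by norm_num) (by have := w.2; omega)).symm
          _ ≤ _ := by
            apply Nat.log_mono_right
            have : n ≤ n * n := Nat.le_mul_self n
            omega
    · push Not at hφ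
      -- A formula that is malformed or uses a forbidden operator is found in the first round; the
      -- factor `tdParam x + 1` pays for that round, whatever the parameter is.
      refine At.mono (round_spec A w (T := 0) (fun φ h => absurd h (hφ φ)) fun _ => ?_) ?_ le_rfl
      · rintro ⟨⟨n', m', A', w', ψ⟩, he, ho, -⟩
        obtain ⟨rfl, rfl, rfl⟩ := header_inj (A := A') (A' := A) (w := w') (w' := w) he
        obtain ⟨φ, h⟩ := exists_toks hOp hX.1 ψ ho
        exact hφ φ h
      · refine le_trans ?_ (Nat.le_mul_of_pos_right _ (Nat.succ_pos _))
        refine le_trans ?_ (roundTime_mono (n := n) (m := m) (l := y.length) (by omega) (by omega) (by omega))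
        simp [roundTime]
        omega
  · rintro hn ⟨⟨n, m, A, w, ψ⟩, he, -⟩
    exact hn n m A w ψ.encode he.symm

/-- With N = |x|, `roundTime N N N` is 6N² + 12N + 8, and the header costs 4N² + 9N + 5. The sum is
the polynomial. -/
theorem machine_decidesWithin {Op : Set TempOp} (hOp : Op ⊆ {TempOp.X})
    (hX : TempOp.X ∈ Op ↔ nx = true) :
    (machine nx).DecidesWithin (LTLMC Op).langᶜ
      (fun x => (tdParam x + 1) * (10 * Polynomial.X ^ 2 + 21 * Polynomial.X + 13 : Polynomial ℕ).eval x.length)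
      (fun x => 1 * (tdParam x * Nat.log 2 x.length)) := by
  have hinit : ∀ x, (machine nx).initCfg x = ⟨some .readN, none, Store.get { F := x.map .inl }⟩ := by
    intro x
    have : (fun _ => [] : Stack → List Sym) = Store.get {} := by
      funext k
      cases k <;> rfl
    have h2 := Store.update_get {} .F (x.map .inl)
    rw [← this] at h2
    exact congrArg (fun s => (⟨some .readN, none, s⟩ : (machine nx).Cfg)) h2
  constructor
  · intro x t g c h
    rw [hinit] at h
    obtain ⟨h1, h2⟩ := (main_spec hOp hX x none).1 t g c h
    refine ⟨h1.trans ?_, h2.trans (by simp)⟩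
    simp only [Polynomial.eval_add, Polynomial.eval_mul, Polynomial.eval_pow, Polynomial.eval_X,
      Polynomial.eval_ofNat]
    simp only [roundTime]
    nlinarith [Nat.zero_le (tdParam x * x.length ^ 2), Nat.zero_le (tdParam x * x.length)]
  · intro x
    rw [NTM.Accepts, hinit]
    exact (main_spec hOp hX x none).2.symm

end correct

/-! ### The parameter is computable -/

section parse

/-- The arity of an operator. -/
def arity : Letter → ℕ
  | .and => 2
  | .untl => 2
  | _ => 1

/-- The contribution of an operator to the temporal depth. -/
def depth : Letter → ℕ
  | .next => 1
  | .fin => 1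
  | .glob => 1
  | .untl => 1
  | _ => 0

/-- One step of reading a formula from right to left. The state holds `0` or one more than
the number of letters `one` after the current proposition, and the temporal depths of the formulas
that have been read. -/
def parseStep (m : ℕ) (a : Letter) (s : ℕ × List ℕ) : Option (ℕ × List ℕ) :=
  if a = .sep then (if s.1 = 0 then some (1, s.2) else none)
  else if a = .one then (if s.1 = 0 then none else some (s.1 + 1, s.2))
  else if a = .zero then none
  else if a = .var then (if s.1 = 0 then none else if s.1 ≤ m then some (0, 0 :: s.2) else none)
  else if s.1 = 0 then (if arity a ≤ s.2.length then
      some (0, (max s.2.headI (s.2.take (arity a)).tail.headI + depth a) :: s.2.drop (arity a))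
    else none)
  else none

/-- Read formulas over `m` propositions from right to left. -/
def parse (m : ℕ) (y : List Letter) : Option (ℕ × List ℕ) :=
  y.foldr (fun a s => s.bind (parseStep m a)) (some (0, []))

variable {m : ℕ}

@[simp] theorem parse_cons (a : Letter) (y : List Letter) :
    parse m (a :: y) = (parse m y).bind (parseStep m a) := rfl

theorem parse_replicate {k : ℕ} {y : List Letter} {l : List ℕ} (h : parse m y = some (0, l)) :
    parse m (List.replicate k Letter.one ++ Letter.sep :: y) = some (k + 1, l) := by
  induction k with
  | zero => simp [h, parseStep]
  | succ k ih => simp [List.replicate_succ, ih, parseStep]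

/-- Reading from the right, the depths of the arguments are on top of the stack when their operator
is reached. -/
theorem parse_encode (φ : LTL (Fin m)) {y : List Letter} {l : List ℕ}
    (h : parse m y = some (0, l)) : parse m (φ.encode ++ y) = some (0, φ.td :: l) := by
  induction φ generalizing y l with
  | var p =>
    have := parse_replicate (k := p) h
    simp [LTL.encode, this, parseStep, LTL.td]
  | neg φ ih => simp [LTL.encode, ih h, parseStep, arity, depth, LTL.td]
  | next φ ih => simp [LTL.encode, ih h, parseStep, arity, depth, LTL.td]
  | fin φ ih => simp [LTL.encode, ih h, parseStep, arity, depth, LTL.td]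
  | glob φ ih => simp [LTL.encode, ih h, parseStep, arity, depth, LTL.td]
  | and φ ψ ih₁ ih₂ => simp [LTL.encode, ih₁ (ih₂ h), parseStep, arity, depth, LTL.td]
  | untl φ ψ ih₁ ih₂ => simp [LTL.encode, ih₁ (ih₂ h), parseStep, arity, depth, LTL.td]

/-- Soundness of the parser. The second alternative is a reading that stops inside the index of a
proposition. -/
theorem exists_of_parse {y : List Letter} {c : ℕ} {l : List ℕ} (h : parse m y = some (c, l)) :
    ∃ φs : List (LTL (Fin m)), l.length = φs.length ∧
      ((c = 0 ∧ y = φs.flatMap LTL.encode) ∨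
        ∃ k, c = k + 1 ∧ y = List.replicate k Letter.one ++ Letter.sep :: φs.flatMap LTL.encode) := by
  induction y generalizing c l with
  | nil =>
    cases h
    exact ⟨[], rfl, .inl ⟨rfl, rfl⟩⟩
  | cons a y ih =>
    rw [parse_cons] at h
    obtain ⟨⟨c', l'⟩, h', h⟩ := Option.bind_eq_some_iff.1 h
    obtain ⟨φs, hl, hφ⟩ := ih h'
    have unary : ∀ f : LTL (Fin m) → LTL (Fin m), (∀ φ, (f φ).encode = a :: φ.encode) →
        c' = 0 → c = 0 → 1 ≤ l'.length → l.length = l'.length → ∃ φs : List (LTL (Fin m)), l.length = φs.length ∧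
      ((c = 0 ∧ a :: y = φs.flatMap LTL.encode) ∨
        ∃ k, c = k + 1 ∧ a :: y = List.replicate k Letter.one ++ Letter.sep :: φs.flatMap LTL.encode) := by
      rintro f hf rfl rfl h1 hl'
      rcases φs with _ | ⟨φ, φs⟩
      · simp at hl
        simp [hl] at h1
      · refine ⟨f φ :: φs, by rw [hl', hl]; rfl, .inl ⟨rfl, ?_⟩⟩
        simpa [hf] using hφ
    have binary : ∀ f : LTL (Fin m) → LTL (Fin m) → LTL (Fin m),
        (∀ φ ψ, (f φ ψ).encode = a :: (φ.encode ++ ψ.encode)) →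
        c' = 0 → c = 0 → 2 ≤ l'.length → l.length + 1 = l'.length → ∃ φs : List (LTL (Fin m)), l.length = φs.length ∧
      ((c = 0 ∧ a :: y = φs.flatMap LTL.encode) ∨
        ∃ k, c = k + 1 ∧ a :: y = List.replicate k Letter.one ++ Letter.sep :: φs.flatMap LTL.encode) := by
      rintro f hf rfl rfl h1 hl'
      rcases φs with _ | ⟨φ, _ | ⟨ψ, φs⟩⟩
      · simp at hl
        simp [hl] at h1
      · rw [hl] at h1
        simp at h1
      · refine ⟨f φ ψ :: φs, by simp at hl ⊢; omega, .inl ⟨rfl, ?_⟩⟩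
        simpa [hf] using hφ
    have un : ∀ d, (if c' = 0 then if 1 ≤ l'.length then
          some (0, (max l'.headI 0 + d) :: l'.drop 1) else none else none) = some (c, l) →
        c' = 0 ∧ c = 0 ∧ 1 ≤ l'.length ∧ l.length = l'.length := by
      intro d h
      split_ifs at h with h1 h2
      cases h
      simp
      omega
    have bin : ∀ d, (if c' = 0 then if 2 ≤ l'.length then
          some (0, (max l'.headI (l'.take 2).tail.headI + d) :: l'.drop 2) else none else none) =
            some (c, l) →
        c' = 0 ∧ c = 0 ∧ 2 ≤ l'.length ∧ l.length + 1 = l'.length := by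
      intro d h
      split_ifs at h with h1 h2
      cases h
      simp
      omega
    -- For arity one nothing follows the head, and the default 0 of `headI` is neutral for `max`.
    have htake : (l'.take 1).tail.headI = 0 := by cases l' <;> rfl
    cases a <;> simp only [parseStep, reduceCtorEq, if_true, if_false, arity, depth, htake] at h
    case sep =>
      split_ifs at h with h1
      cases h
      refine ⟨φs, hl, .inr ⟨0, rfl, ?_⟩⟩
      simpa [h1] using hφ
    case one =>
      split_ifs at h with h1
      cases h
      refine ⟨φs, hl, .inr ⟨c', rfl, ?_⟩⟩
      rcases hφ with hφ | ⟨k, rfl, rfl⟩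
      · exact absurd hφ.1 h1
      · rfl
    case var =>
      split_ifs at h with h1 h2
      cases h
      rcases hφ with hφ | ⟨k, rfl, rfl⟩
      · exact absurd hφ.1 h1
      -- The counter is k + 1, so its test against `m` is exactly `k < m`.
      · exact ⟨.var ⟨k, h2⟩ :: φs, by simp [hl], .inl ⟨rfl, by simp [LTL.encode]⟩⟩
    case neg => obtain ⟨h1, h2, h3, h4⟩ := un _ h; exact unary .neg (fun _ => rfl) h1 h2 h3 h4
    case next => obtain ⟨h1, h2, h3, h4⟩ := un _ h; exact unary .next (fun _ => rfl) h1 h2 h3 h4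
    case fin => obtain ⟨h1, h2, h3, h4⟩ := un _ h; exact unary .fin (fun _ => rfl) h1 h2 h3 h4
    case glob => obtain ⟨h1, h2, h3, h4⟩ := un _ h; exact unary .glob (fun _ => rfl) h1 h2 h3 h4
    case and => obtain ⟨h1, h2, h3, h4⟩ := bin _ h; exact binary .and (fun _ _ => rfl) h1 h2 h3 h4
    case untl => obtain ⟨h1, h2, h3, h4⟩ := bin _ h; exact binary .untl (fun _ _ => rfl) h1 h2 h3 h4

theorem exists_of_parse_one {y : List Letter} {l : List ℕ} (h : parse m y = some (0, l))
    (hl : l.length = 1) : ∃ φ : LTL (Fin m), φ.encode = y := by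
  obtain ⟨φs, hφs, ⟨-, hy⟩ | ⟨k, hk, -⟩⟩ := exists_of_parse h
  · obtain ⟨φ, rfl⟩ := List.length_eq_one_iff.1 (hφs.symm.trans hl)
    exact ⟨φ, by simp [hy]⟩
  · cases hk

open Primrec in
theorem primrec_parseStep :
    Primrec fun p : ℕ × Letter × (ℕ × List ℕ) => parseStep p.1 p.2.1 p.2.2 := by
  have ha : Primrec fun p : ℕ × Letter × (ℕ × List ℕ) => p.2.1 := fst.comp snd
  have hc : Primrec fun p : ℕ × Letter × (ℕ × List ℕ) => p.2.2.1 := fst.comp (snd.comp snd)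
  have hl : Primrec fun p : ℕ × Letter × (ℕ × List ℕ) => p.2.2.2 := snd.comp (snd.comp snd)
  have hL : ∀ b : Letter, PrimrecPred fun p : ℕ × Letter × (ℕ × List ℕ) => p.2.1 = b := fun b =>
    Primrec.eq.comp ha (.const b)
  have h0 : PrimrecPred fun p : ℕ × Letter × (ℕ × List ℕ) => p.2.2.1 = 0 :=
    Primrec.eq.comp hc (.const 0)
  have har : Primrec fun p : ℕ × Letter × (ℕ × List ℕ) => arity p.2.1 :=
    (dom_finite arity).comp ha
  have hde : Primrec fun p : ℕ × Letter × (ℕ × List ℕ) => depth p.2.1 :=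
    (dom_finite depth).comp ha
  unfold parseStep
  refine ite (hL _) (ite h0 (option_some.comp (.pair (.const 1) hl)) (.const none)) ?_
  refine ite (hL _) (ite h0 (.const none) (option_some.comp (.pair (succ.comp hc) hl))) ?_
  refine ite (hL _) (.const none) ?_
  refine ite (hL _) (ite h0 (.const none) (ite (nat_le.comp hc fst)
    (option_some.comp (.pair (.const 0) (list_cons.comp (.const 0) hl))) (.const none))) ?_
  refine ite h0 (ite (nat_le.comp har (list_length.comp hl)) ?_ (.const none)) (.const none)
  refine option_some.comp (.pair (.const 0) (list_cons.comp ?_ (list_drop.comp har hl)))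
  exact nat_add.comp (nat_max.comp (list_headI.comp hl)
    (list_headI.comp (list_tail.comp (list_take.comp har hl)))) hde

open Primrec in
theorem primrec_parse : Primrec₂ parse := by
  refine (list_foldr (f := fun p : ℕ × List Letter => p.2) (g := fun _ => some (0, []))
    (h := fun p q => q.2.bind (parseStep p.1 q.1)) snd (.const _) ?_ : Primrec fun p : ℕ × List Letter => parse p.1 p.2)
  refine option_bind (snd.comp snd) ?_
  exact primrec_parseStep.comp (.pair (fst.comp (fst.comp fst)) (.pair (fst.comp (snd.comp fst)) snd))

end parse

/-! ### Taking a word apart -/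

section computable

/-- The number of letters before the first separator. -/
def unary (x : List Letter) : ℕ := x.idxOf Letter.sep

/-- The letters after the first separator. -/
def rest (x : List Letter) : List Letter := x.drop (unary x + 1)

/-- The first `n` blocks of length `k`. -/
def blocks (n k : ℕ) (x : List Letter) : List (List Letter) :=
  (List.range n).map fun i => (x.drop (i * k)).take k

/-- A word of the form `one … one sep y`. -/
def unaryCons (n : ℕ) (y : List Letter) : List Letter :=
  (List.range n).map (fun _ => Letter.one) ++ Letter.sep :: y

/-- The form with `List.range` is convenient for primitive recursion, the form with `List.replicate`
is that of the encoding. -/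
theorem unaryCons_eq (n : ℕ) (y : List Letter) :
    unaryCons n y = List.replicate n Letter.one ++ Letter.sep :: y := by
  simp [unaryCons]

theorem unary_replicate (n : ℕ) (y : List Letter) :
    unary (List.replicate n Letter.one ++ Letter.sep :: y) = n := by
  rw [unary, List.idxOf_append_of_notMem (by simp [List.mem_replicate])]
  simp

theorem rest_replicate (n : ℕ) (y : List Letter) :
    rest (List.replicate n Letter.one ++ Letter.sep :: y) = y := by
  rw [rest, unary_replicate, List.drop_append]
  simp

theorem blocks_flatten {k : ℕ} {rows : List (List Letter)} (h : ∀ r ∈ rows, r.length = k)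
    (y : List Letter) : blocks rows.length k (rows.flatten ++ y) = rows := by
  induction rows with
  | nil => rfl
  | cons r rows ih =>
    have hr : r.length = k := h r (by simp)
    have := ih fun r hr => h r (by simp [hr])
    simp only [blocks, List.length_cons, List.range_succ_eq_map, List.map_cons, List.map_map,
      List.flatten_cons, List.append_assoc] at this ⊢
    congr 1
    · simp [← hr]
    · conv_rhs => rw [← this]
      refine List.map_congr_left fun i _ => ?_
      simp only [Function.comp_apply, Nat.succ_eq_add_one, Nat.succ_mul]
      rw [Nat.add_comm, ← List.drop_drop, List.drop_left' hr]

variable (x : List Letter)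

/-- The parts of an instance, as read from a word. -/
def wordN : ℕ := unary x
def wordM : ℕ := unary (rest x)
def wordR : List (List Letter) := blocks (wordN x) (wordN x) (rest (rest x))
def wordV : List (List Letter) :=
  blocks (wordN x) (wordM x) ((rest (rest x)).drop (wordN x * wordN x))
def wordW : ℕ := unary ((rest (rest x)).drop (wordN x * wordN x + wordN x * wordM x))
def wordY : List Letter := rest ((rest (rest x)).drop (wordN x * wordN x + wordN x * wordM x))

/-- The word is an instance. -/
def Good : Prop :=
  x = unaryCons (wordN x) (unaryCons (wordM x) ((wordR x).flatten ++ ((wordV x).flatten ++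
    unaryCons (wordW x) (wordY x)))) ∧ wordW x < wordN x ∧
  (∀ r ∈ wordR x, r.length = wordN x ∧ (∃ a ∈ r, a = Letter.one) ∧
    ∀ a ∈ r, a = Letter.one ∨ a = Letter.zero) ∧
  (∀ r ∈ wordV x, r.length = wordM x ∧ ∀ a ∈ r, a = Letter.one ∨ a = Letter.zero) ∧
  (parse (wordM x) (wordY x)).map (fun s => (s.1, s.2.length)) = some (0, 1)

open Classical in
/-- The temporal depth of the formula of an instance. -/
noncomputable def wordTd : ℕ :=
  if Good x then ((parse (wordM x) (wordY x)).getD (0, [])).2.headI else 0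

-- Everything is composed of list operations and the parser, and the quantifiers in `Good` range
-- over members of computed lists.
open Primrec in
theorem primrec_wordTd : Primrec wordTd := by
  have hsep : Primrec unary := list_idxOf.comp (.const _) .id
  have hrest : Primrec rest := list_drop.comp (succ.comp hsep) .id
  have hblocks : Primrec fun p : ℕ × ℕ × List Letter => blocks p.1 p.2.1 p.2.2 := by
    unfold blocks
    refine list_map (list_range.comp fst) ?_
    exact list_take.comp (fst.comp (snd.comp fst)) (list_drop.comp
      (nat_mul.comp snd (fst.comp (snd.comp fst))) (snd.comp (snd.comp fst)))
  have hcons : Primrec₂ unaryCons := by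
    unfold unaryCons
    exact list_append.comp (list_map (list_range.comp fst) (.const _))
      (list_cons.comp (.const _) snd)
  have hN : Primrec wordN := hsep
  have hM : Primrec wordM := hsep.comp hrest
  have hrr : Primrec fun x => rest (rest x) := hrest.comp hrest
  have hNN : Primrec fun x => wordN x * wordN x := nat_mul.comp hN hN
  have hNM : Primrec fun x => wordN x * wordN x + wordN x * wordM x :=
    nat_add.comp hNN (nat_mul.comp hN hM)
  have hR : Primrec wordR := hblocks.comp (.pair hN (.pair hN hrr))
  have hV : Primrec wordV := hblocks.comp (.pair hN (.pair hM (list_drop.comp hNN hrr)))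
  have hW : Primrec wordW := hsep.comp (list_drop.comp hNM hrr)
  have hY : Primrec wordY := hrest.comp (list_drop.comp hNM hrr)
  have hparse : Primrec fun x => parse (wordM x) (wordY x) := primrec_parse.comp hM hY
  have hone : PrimrecPred fun r : List Letter => ∃ a ∈ r, a = Letter.one :=
    PrimrecPred.exists_mem_list (Primrec.eq.comp .id (.const _))
  have hbits : PrimrecPred fun r : List Letter => ∀ a ∈ r, a = Letter.one ∨ a = Letter.zero :=
    PrimrecPred.forall_mem_list ((Primrec.eq.comp .id (.const _)).or (Primrec.eq.comp .id (.const _)))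
  have hgR : PrimrecRel fun (L : List (List Letter)) (k : ℕ) => ∀ r ∈ L, r.length = k ∧
      (∃ a ∈ r, a = Letter.one) ∧ ∀ a ∈ r, a = Letter.one ∨ a = Letter.zero :=
    PrimrecRel.forall_mem_list (R := fun (r : List Letter) (k : ℕ) => r.length = k ∧
      (∃ a ∈ r, a = Letter.one) ∧ ∀ a ∈ r, a = Letter.one ∨ a = Letter.zero)
      ((Primrec.eq.comp (list_length.comp fst) snd).and ((hone.comp fst).and (hbits.comp fst)))
  have hgV : PrimrecRel fun (L : List (List Letter)) (k : ℕ) => ∀ r ∈ L, r.length = k ∧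
      ∀ a ∈ r, a = Letter.one ∨ a = Letter.zero :=
    PrimrecRel.forall_mem_list (R := fun (r : List Letter) (k : ℕ) => r.length = k ∧
      ∀ a ∈ r, a = Letter.one ∨ a = Letter.zero)
      ((Primrec.eq.comp (list_length.comp fst) snd).and (hbits.comp fst))
  have hgood : PrimrecPred Good := by
    unfold Good
    refine PrimrecPred.and ?_ (PrimrecPred.and ?_ (PrimrecPred.and ?_ (PrimrecPred.and ?_ ?_)))
    · exact Primrec.eq.comp .id (hcons.comp hN (hcons.comp hM (list_append.comp
        (list_flatten.comp hR) (list_append.comp (list_flatten.comp hV) (hcons.comp hW hY)))))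
    · exact nat_lt.comp hW hN
    · exact hgR.comp hR hN
    · exact hgV.comp hV hM
    · exact Primrec.eq.comp (option_map hparse
        (Primrec.pair (fst.comp snd) (list_length.comp (snd.comp snd)))) (.const _)
  classical
  exact Primrec.ite hgood (list_headI.comp (snd.comp (option_getD.comp hparse (.const _)))) (.const 0)

/-! ### The parts of a word and the encoding agree -/

/-- The letter for a truth value. -/
def letter (b : Bool) : Letter := if b then Letter.one else Letter.zero

variable {n m : ℕ} {x}

theorem header_eq (A : Kripke (Fin n) (Fin m)) (w : Fin n) (y : List Letter) :
    header A w y = unaryCons n (unaryCons m (((rowsR A).map (List.map letter)).flatten ++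
      (((rowsV A).map (List.map letter)).flatten ++ unaryCons w y))) := by
  have h1 : ∀ i j, letter (adj A i j) = MCInstance.bit (A.R i j) := by
    intro i j
    by_cases h : A.R i j <;> simp [letter, adj, MCInstance.bit, h]
  have h2 : ∀ i p, letter (vals A i p) = MCInstance.bit (p ∈ A.V i) := by
    intro i p
    by_cases h : p ∈ A.V i <;> simp [letter, vals, MCInstance.bit, h]
  simp [header, unaryCons_eq, rowsR, rowsV, List.flatMap, Function.comp_def, h1, h2]

theorem word_header (A : Kripke (Fin n) (Fin m)) (w : Fin n) (y : List Letter) :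
    wordN (header A w y) = n ∧ wordM (header A w y) = m ∧
    wordR (header A w y) = (rowsR A).map (List.map letter) ∧
    wordV (header A w y) = (rowsV A).map (List.map letter) ∧
    wordW (header A w y) = w ∧ wordY (header A w y) = y := by
  have hR : ((rowsR A).map (List.map letter)).length = n := by simp [rowsR]
  have hV : ((rowsV A).map (List.map letter)).length = n := by simp [rowsV]
  have hR' : ∀ r ∈ (rowsR A).map (List.map letter), r.length = n := by simp [rowsR]
  have hV' : ∀ r ∈ (rowsV A).map (List.map letter), r.length = m := by simp [rowsV]
  have hRl : ((rowsR A).map (List.map letter)).flatten.length = n * n := by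
    simp [rowsR, List.length_flatten, Function.comp_def]
  have hVl : ((rowsV A).map (List.map letter)).flatten.length = n * m := by
    simp [rowsV, List.length_flatten, Function.comp_def]
  have hN : wordN (header A w y) = n := by
    rw [wordN, header_eq, unaryCons_eq, unary_replicate]
  have hrest : rest (header A w y) = unaryCons m (((rowsR A).map (List.map letter)).flatten ++
      (((rowsV A).map (List.map letter)).flatten ++ unaryCons w y)) := by
    rw [header_eq, unaryCons_eq, rest_replicate]
  have hM : wordM (header A w y) = m := by
    rw [wordM, hrest, unaryCons_eq, unary_replicate]
  have hrr : rest (rest (header A w y)) = ((rowsR A).map (List.map letter)).flatten ++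
      (((rowsV A).map (List.map letter)).flatten ++ unaryCons w y) := by
    rw [hrest, unaryCons_eq, rest_replicate]
  have hd : (rest (rest (header A w y))).drop (n * n) =
      ((rowsV A).map (List.map letter)).flatten ++ unaryCons w y := by
    rw [hrr, List.drop_left' hRl]
  have hd' : (rest (rest (header A w y))).drop (n * n + n * m) = unaryCons w y := by
    rw [← List.drop_drop, hd, List.drop_left' hVl]
  refine ⟨hN, hM, ?_, ?_, ?_, ?_⟩
  · have := blocks_flatten hR' (((rowsV A).map (List.map letter)).flatten ++ unaryCons w y)
    rw [hR, ← hrr] at this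
    rw [wordR, hN, this]
  · have := blocks_flatten hV' (unaryCons w y)
    rw [hV, ← hd] at this
    rw [wordV, hN, hM, this]
  · rw [wordW, hN, hM, hd', unaryCons_eq, unary_replicate]
  · rw [wordY, hN, hM, hd', unaryCons_eq, rest_replicate]

theorem exists_eq_map_letter {r : List Letter} (h : ∀ a ∈ r, a = Letter.one ∨ a = Letter.zero) :
    r = (r.map fun a => decide (a = Letter.one)).map letter := by
  rw [List.map_map]
  conv_lhs => rw [← List.map_id r]
  refine List.map_congr_left fun a ha => ?_
  rcases h a ha with rfl | rfl <;> rfl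

/-- `Good` demands that the parts reassemble to the word, so it does not matter how the word was
cut. -/
theorem exists_of_good (h : Good x) : ∃ I : MCInstance, I.encode = x := by
  obtain ⟨hx, hW, hR, hV, hp⟩ := h
  obtain ⟨⟨c, l⟩, hp, hl⟩ := Option.map_eq_some_iff.1 hp
  simp only [Prod.mk.injEq] at hl
  obtain ⟨rfl, hl⟩ := hl
  obtain ⟨φ, hφ⟩ := exists_of_parse_one hp hl
  obtain ⟨A, hA, hA'⟩ := exists_kripke (n := wordN x) (m := wordM x)
    (rows := (wordR x).map (List.map fun a => decide (a = Letter.one)))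
    (vrows := (wordV x).map (List.map fun a => decide (a = Letter.one)))
    (by simp [wordR, blocks])
    (by
      intro r hr
      obtain ⟨r, hr', rfl⟩ := List.mem_map.1 hr
      obtain ⟨h1, ⟨a, ha, rfl⟩, -⟩ := hR r hr'
      exact ⟨by simpa using h1, List.mem_map.2 ⟨_, ha, by simp⟩⟩)
    (by simp [wordV, blocks])
    (by
      intro r hr
      obtain ⟨r, hr', rfl⟩ := List.mem_map.1 hr
      simpa using (hV r hr').1)
  refine ⟨⟨_, _, A, ⟨_, hW⟩, φ⟩, ?_⟩
  have hl : ∀ L : List (List Letter), (∀ r ∈ L, ∀ a ∈ r, a = Letter.one ∨ a = Letter.zero) →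
      (L.map (List.map fun a => decide (a = Letter.one))).map (List.map letter) = L := by
    intro L hL
    rw [List.map_map]
    conv_rhs => rw [← List.map_id L]
    exact List.map_congr_left fun r hr => (exists_eq_map_letter (hL r hr)).symm
  change header A ⟨_, hW⟩ φ.encode = x
  rw [header_eq, ← hA, ← hA', hl _ fun r hr => (hR r hr).2.2, hl _ fun r hr => (hV r hr).2, hφ]
  exact hx.symm

/-- An instance passes the test, and the parser leaves just its depth on the stack. A word that is
no instance fails the test, and both sides are 0. -/
theorem tdParam_eq_wordTd (x : List Letter) : tdParam x = wordTd x := by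
  by_cases hx : ∃ I : MCInstance, I.encode = x
  · obtain ⟨I, rfl⟩ := hx
    obtain ⟨n, m, A, w, φ⟩ := I
    rw [tdParam_encode]
    change φ.td = wordTd (header A w φ.encode)
    obtain ⟨hN, hM, hR, hV, hW, hY⟩ := word_header A w φ.encode
    have hparse : parse m φ.encode = some (0, [φ.td]) := by
      simpa using parse_encode φ (y := []) (l := []) rfl
    have hgood : Good (header A w φ.encode) := by
      have hl : ∀ b, letter b = Letter.one ∨ letter b = Letter.zero := by
        intro b
        cases b <;> simp [letter]
      rw [Good, hN, hM, hR, hV, hW, hY, hparse]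
      refine ⟨header_eq _ _ _, w.2, ?_, ?_, rfl⟩
      · intro r hr
        simp only [rowsR, List.mem_map, List.map_map] at hr
        obtain ⟨i, -, rfl⟩ := hr
        obtain ⟨j, hj⟩ := A.total i
        refine ⟨by simp, ⟨_, ?_, rfl⟩, ?_⟩
        · simp only [Function.comp_apply, List.map_map, List.mem_map]
          exact ⟨j, List.mem_finRange j, by simp [adj, hj, letter]⟩
        · intro a ha
          obtain ⟨b, -, rfl⟩ := List.mem_map.1 ha
          exact hl b
      · intro r hr
        simp only [rowsV, List.mem_map, List.map_map] at hr
        obtain ⟨i, -, rfl⟩ := hr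
        refine ⟨by simp, ?_⟩
        intro a ha
        obtain ⟨b, -, rfl⟩ := List.mem_map.1 ha
        exact hl b
    rw [wordTd, if_pos hgood, hM, hY, hparse]
    rfl
  · rw [tdParam, dif_neg hx, wordTd, if_neg fun h => hx (exists_of_good h)]

theorem computable_tdParam : Computable tdParam := by
  rw [funext tdParam_eq_wordTd]
  exact primrec_wordTd.to_comp

end computable

end NextMC

theorem mainTheorem11 (T : Set TempOp) (hT : T ⊆ {TempOp.X}) : LTLMC T ∈ coWP Letter := by
  classical
  -- k + 1 is the number of rounds at depth k.
  exact ⟨NextMC.computable_tdParam, fun k => k + 1, _, 1, NextMC.machine (decide (TempOp.X ∈ T)),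
    Computable.succ, NextMC.machine_decidesWithin hT (by simp)⟩
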